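/- **Evolution of blockage: horizontal finite range.** Let $\lambda>0$, $R>0$, and let $\mathcal L$ be a probability measure on $\mathbb R_+$ with finite mean and distribution function $F$. Let $\mathfrak F(y)=-\int_y^{\infty}(1-F(u))\,\mathrm du$, $y\in\mathbb R$, be the primitive of $1-F$ that tends to $0$ at $+\infty$. Let $L$ be a Poisson building process with intensity $\lambda$ and height distribution $\mathcal L$: the random set of points $(x,h)\in\mathbb R\times\mathbb R_+$ (buildings) whose first coordinates form a Poisson point process on $\mathbb R$ of intensity $\lambda$, marked with i.i.d. heights of law $\mathcal L$ that are independent of this process. Let $(x_0,h_0)$ be a random point of $\mathbb R\times\mathbb R_+$ with law $\mu$, independent of $L$. The blocking building of a point $(x,y)$ is the unique maximiser of $\frac{b-y}{a-x}$ among the buildings $(a,b)\in L$ with $a\in\,]x,x+R]$, if there is one. Let $(X_0,H_0)=(x_0,h_0)$, and let $(X_{n+1},H_{n+1})$ be the blocking building of $(X_n,H_n)$; the sequence is sent to a cemetery state as soon as no blocking building exists. Let $N\ge 0$ be an integer. Then the restriction of the law of $(X_n,H_n)_{0\le n\le N}$ to $(\mathbb R\times\mathbb R_+)^{N+1}$,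 that is, to the event that a blocking building is found at each of the $N$ steps, has a density $g_{N,R}$ with respect to $\mu\otimes\bigotimes_{i=1}^N(\mathrm{Leb}\otimes\mathcal L)$, where $\mathrm{Leb}$ is Lebesgue measure on $\mathbb R$. For a configuration $(x_n,h_n)_{0\le n\le N}$ write $t_i=\frac{h_i-h_{i-1}}{x_i-x_{i-1}}$ for $1\le i\le N$, $t_0=+\infty$, and $r_i=R-(x_i-x_{i-1})$ (leftover signal range). Then $$g_{N,R}=\lambda^N e^{-\lambda E}\ \prod_{i=1}^N\mathbf 1_{x_i\in\,]x_{i-1},x_{i-1}+R]}\ \prod_{i=2}^N\mathbf 1_{t_i<t_{i-1}\text{ or }x_i>x_{i-2}+R},$$ where, if $N\ge1$, $x_0<x_1<\dots<x_N$ and no $t_i$ is zero, $$E=\frac{\mathfrak F(h_{N-1}+Rt_N)}{t_N}-\frac{\mathfrak F(h_0)}{t_1}+\sum_{i=1}^{N-1}\mathfrak F(h_i)\Bigl(\frac1{t_i}-\frac1{t_i\wedge t_{i+1}}\Bigr)+\sum_{i=1}^{N-1}\Bigl(\frac{\mathfrak F(h_i+r_i(t_i\wedge t_{i+1}))}{t_i\wedge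 t_{i+1}}-\frac{\mathfrak F(h_i+r_it_{i+1})}{t_{i+1}}\Bigr).$$ In general, put $Q(h,r,t)=\frac{\mathfrak F(h+rt)-\mathfrak F(h)}{t}$ for $t\ne0$ and $Q(h,r,0)=\lim_{t\uparrow0}Q(h,r,t)=r\,\mathcal L([h,\infty[)$. Then, with $\ell_i=x_i-x_{i-1}$ for $i<N$ and $\ell_N=R$, $$E=\sum_{i=1}^{N}Q(h_{i-1},\ell_i,t_i)+\sum_{i=1}^{N-1}\bigl(Q(h_i,r_i,t_i\wedge t_{i+1})-Q(h_i,r_i,t_{i+1})\bigr)$$ (so that $E=0$ and $g_{0,R}=1$ if $N=0$), and this agrees with the previous expression for $E$ in the case considered there. -/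

import Mathlib

open MeasureTheory ProbabilityTheory
open scoped NNReal ENNReal

noncomputable section

namespace Blockage

/-- The half plane `ℝ × ℝ₊`. A point `(x, h)` of a landscape is the building with base `x` and
height `h`. -/
abbrev HalfPlane : Type := ℝ × ℝ≥0

/-! ### Poisson building processes -/

section RandomLandscape

variable {Ω : Type*} [MeasurableSpace Ω]

/-- The number of points of the random sequence `X` that lie in `B`. -/
def count (X : ℕ → Ω → ℝ) (B : Set ℝ) (ω : Ω) : ℕ∞ := {k : ℕ | X k ω ∈ B}.encard

/-- `X 0, X 1, …` is an enumeration, in some order, of the points of a (simple) homogeneous Poisson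
point process on `ℝ` with intensity `lam`: the numbers of points in Borel sets of finite Lebesgue
measure are Poisson variables with parameter `lam` times the measure, and the numbers of points in
disjoint Borel sets are independent. -/
structure IsPoissonProcess (P : Measure Ω) (lam : ℝ≥0) (X : ℕ → Ω → ℝ) : Prop where
  measurable : ∀ k, Measurable (X k)
  simple : ∀ᵐ ω ∂P, Function.Injective (fun k => X k ω)
  count_law : ∀ B : Set ℝ, MeasurableSet B → volume B ≠ ∞ →
    HasLaw (count X B) ((poissonMeasure (lam * (volume B).toNNReal)).map (Nat.cast : ℕ → ℕ∞)) P
  count_indep : ∀ (m : ℕ) (B : Fin m → Set ℝ), (∀ i, MeasurableSet (B i)) →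
    Pairwise (fun i j => Disjoint (B i) (B j)) → iIndepFun (fun i => count X (B i)) P

/-- `(X k, H k)`, `k ∈ ℕ`, are the buildings of a Poisson building process with intensity `lam` and
height distribution `𝓛`: the bases form a Poisson point process on `ℝ` with intensity `lam`, the
heights are i.i.d. with law `𝓛`, and the heights are independent of the bases. -/
structure IsPoissonBuildingProcess (P : Measure Ω) (lam : ℝ≥0) (𝓛 : Measure ℝ≥0)
    (X : ℕ → Ω → ℝ) (H : ℕ → Ω → ℝ≥0) : Prop where
  bases : IsPoissonProcess P lam X
  heights_measurable : ∀ k, Measurable (H k)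
  heights_law : ∀ k, P.map (H k) = 𝓛
  heights_indep : iIndepFun H P
  indep : IndepFun (fun ω k => X k ω) (fun ω k => H k ω) P

/-- The landscape formed by the buildings `(X k, H k)`. -/
def landscape (X : ℕ → Ω → ℝ) (H : ℕ → Ω → ℝ≥0) (ω : Ω) : Set HalfPlane :=
  Set.range fun k => (X k ω, H k ω)

end RandomLandscape

/-! ### Blockage with horizontal range `R` -/

/-- The slope of the line through two points of the half plane. -/
def slope (p q : HalfPlane) : ℝ := ((q.2 : ℝ) - p.2) / (q.1 - p.1)

/-- `q` is the blocking building of the point `p` in the landscape `L`: it is the (unique) maximiser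
of the slope seen from `p` among the buildings of `L` with base in `]x, x + R]`, `x` being the
abscissa of `p`. -/
def IsBlocking (R : ℝ) (L : Set HalfPlane) (p q : HalfPlane) : Prop :=
  q ∈ L ∧ q.1 ∈ Set.Ioc p.1 (p.1 + R) ∧
    ∀ q' ∈ L, q'.1 ∈ Set.Ioc p.1 (p.1 + R) → q' ≠ q → slope p q' < slope p q

open Classical in
/-- The blocking building of `p` in `L`; the value `none` plays the role of the cemetery point
`(-∞, -∞)`, and means that `p` has no blocking building in range. -/
def blocking (R : ℝ) (L : Set HalfPlane) (p : HalfPlane) : Option HalfPlane :=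
  if h : ∃ q, IsBlocking R L p q then some h.choose else none

/-- The blockage sequence: `p`, its blocking building, the blocking building of the latter, etc. -/
def blockageSeq (R : ℝ) (L : Set HalfPlane) (p : HalfPlane) : ℕ → Option HalfPlane
  | 0 => some p
  | n + 1 => (blockageSeq R L p n).bind (blocking R L)

section RandomLandscape

variable {Ω : Type*}

/-- The event that the first `N` steps of the blockage sequence all find a blocking building. -/
def alwaysFound (R : ℝ) (L : Ω → Set HalfPlane) (start : Ω → HalfPlane) (N : ℕ) : Set Ω :=
  {ω | ∀ n ≤ N, (blockageSeq R (L ω) (start ω) n).isSome}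

/-- The vector `(X_n, H_n)`, `0 ≤ n ≤ N`, of the first points of the blockage sequence (with an
irrelevant value outside of the event `alwaysFound`). -/
def blockagePath (R : ℝ) (L : Ω → Set HalfPlane) (start : Ω → HalfPlane) (N : ℕ) (ω : Ω) :
    Fin (N + 1) → HalfPlane :=
  fun n => (blockageSeq R (L ω) (start ω) n).getD (0, 0)

end RandomLandscape

/-! ### The density -/

/-- The cumulative distribution function `F` of the height distribution `𝓛`. -/
def heightCDF (𝓛 : Measure ℝ≥0) (u : ℝ) : ℝ := 𝓛.real {h : ℝ≥0 | (h : ℝ) ≤ u}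

/-- The function `𝔉`: the primitive of `1 - F` that tends to `0` at `+∞`. -/
def tailPrimitive (𝓛 : Measure ℝ≥0) (y : ℝ) : ℝ := -∫ u in Set.Ioi y, (1 - heightCDF 𝓛 u)

/-- The quotient `(𝔉 (h + r t) - 𝔉 h) / t`, where for `t = 0` the limit of the quotient as `t`
increases to `0` is taken, that is, `r 𝓛([h, ∞[)`. -/
def quotient (𝓛 : Measure ℝ≥0) (h r t : ℝ) : ℝ :=
  if t = 0 then r * 𝓛.real {u : ℝ≥0 | h ≤ (u : ℝ)}
  else (tailPrimitive 𝓛 (h + r * t) - tailPrimitive 𝓛 h) / t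

section Configuration

variable {N : ℕ} (p : Fin (N + 1) → HalfPlane)

/-- The `n`-th point of a configuration `(x_n, h_n)`, `0 ≤ n ≤ N` (indices above `N` are not
used). -/
def pt (n : ℕ) : HalfPlane := p ⟨min n N, by omega⟩

/-- The abscissa `x_n`. -/
def xAt (n : ℕ) : ℝ := (pt p n).1

/-- The height `h_n`. -/
def hAt (n : ℕ) : ℝ := (pt p n).2

/-- The slope `t_n` from `(x_{n-1}, h_{n-1})` to `(x_n, h_n)`, for `1 ≤ n ≤ N`. -/
def tAt (n : ℕ) : ℝ := slope (pt p (n - 1)) (pt p n)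

/-- The leftover signal range `r_n = R - (x_n - x_{n-1})`, for `1 ≤ n ≤ N`. -/
def rAt (R : ℝ) (n : ℕ) : ℝ := R - (xAt p n - xAt p (n - 1))

/-- The exponent of the density, in terms of the quotients `(𝔉 (h + r t) - 𝔉 h) / t`, so that it
makes sense for all slopes. -/
def exponent (𝓛 : Measure ℝ≥0) (R : ℝ) : ℝ :=
  ∑ n ∈ Finset.Icc 1 N,
      quotient 𝓛 (hAt p (n - 1)) (if n = N then R else xAt p n - xAt p (n - 1)) (tAt p n)
    + ∑ n ∈ Finset.Ico 1 N,
      (quotient 𝓛 (hAt p n) (rAt p R n) (min (tAt p n) (tAt p (n + 1)))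
        - quotient 𝓛 (hAt p n) (rAt p R n) (tAt p (n + 1)))

/-- The exponent of the density, written out for non-zero slopes (and `1 ≤ N`). -/
def expandedExponent (𝓛 : Measure ℝ≥0) (R : ℝ) : ℝ :=
  tailPrimitive 𝓛 (hAt p (N - 1) + R * tAt p N) / tAt p N
    - tailPrimitive 𝓛 (hAt p 0) / tAt p 1
    + ∑ i ∈ Finset.Ico 1 N,
      tailPrimitive 𝓛 (hAt p i) * (1 / tAt p i - 1 / min (tAt p i) (tAt p (i + 1)))
    + ∑ i ∈ Finset.Ico 1 N,
      (tailPrimitive 𝓛 (hAt p i + rAt p R i * min (tAt p i) (tAt p (i + 1)))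
          / min (tAt p i) (tAt p (i + 1))
        - tailPrimitive 𝓛 (hAt p i + rAt p R i * tAt p (i + 1)) / tAt p (i + 1))

/-- The constraints on the configurations: every point is in range of the previous one, and in the
shade that the previous one casts from the one before it. -/
def Admissible (R : ℝ) : Prop :=
  (∀ i ∈ Finset.Icc 1 N, xAt p i ∈ Set.Ioc (xAt p (i - 1)) (xAt p (i - 1) + R)) ∧
    ∀ i ∈ Finset.Icc 2 N, tAt p i < tAt p (i - 1) ∨ xAt p (i - 2) + R < xAt p i

open Classical in
/-- The density `g_{N,R}`. -/
def density (lam : ℝ≥0) (𝓛 : Measure ℝ≥0) (R : ℝ) : ℝ≥0∞ :=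
  if Admissible p R then ENNReal.ofReal ((lam : ℝ) ^ N * Real.exp (-(lam : ℝ) * exponent p 𝓛 R))
  else 0

end Configuration

/-- The product measure `μ ⊗ ⨂_{i=1}^N (Leb ⊗ 𝓛)`. -/
def refMeasure (μ : Measure HalfPlane) (𝓛 : Measure ℝ≥0) (N : ℕ) :
    Measure (Fin (N + 1) → HalfPlane) :=
  Measure.pi fun i => if i = 0 then μ else (volume : Measure ℝ).prod 𝓛

end Blockage

end

/-! Almost surely the bases are distinct, and the event that all `N` blocking buildings are found is
then a disjoint union, over injective index tuples `k`, of the events that the buildings `k 0, k 1,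
…` are the successive blocking buildings (`alwaysFound_eq`). For fixed points this event has a
geometric form (`isPath_iff`): the configuration satisfies the constraints of the density, and no
building outside the tuple lies in the forbidden set, the union over `n` of the regions over
`]x_{n-1}, x_{n-1} + R]` on or above the line from the `(n-1)`-st point to the `n`-th.

A sum over tuples of Poisson points with such a void condition is computed by the Mecke formula
(`tsum_lintegral_void`): every chosen point contributes the intensity measure `λ Leb ⊗ 𝓛`, and the
void condition contributes `exp (-λ E)`, with `E` the measure of the forbidden set under `Leb ⊗ 𝓛`.
The formula is derived from the laws of the counts. Independence of counts on disjoint sets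
identifies the factorial moment measures with powers of `λ Leb` (`sum_map_bases`), independent
marking extends this to buildings (`sum_map_buildings`), and inclusion-exclusion turns factorial
moments into void probabilities. In `ℝ≥0∞` the alternating series becomes an identity between its
even and odd parts; the odd part is cancelled at the end, being finite because admissible
configurations lie in a bounded range of the start and `E ≤ N R`.

It remains to compute `E`. Each forbidden point is assigned to the last `n` whose region contains
it. Admissibility makes this a test against region `n + 1` alone, so each piece is a strip over
`]x_{n-1}, x_n]` together with a difference of two strips over the leftover range. The measure of a
strip is a `quotient` (`measure_strip`), which gives `Admissible.measure_forbidden`. -/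

noncomputable section
namespace Blockage

/-! ### Factorial moment measures of a Poisson process -/

section FactorialMoments

variable {Ω : Type*} [MeasurableSpace Ω]

/-- The mean of a Poisson distribution. -/
lemma lintegral_natCast_poissonMeasure (r : ℝ≥0) :
    ∫⁻ n : ℕ, (n : ℝ≥0∞) ∂(poissonMeasure r) = r := by
  have h1 :
      ∑' n : ℕ, ENNReal.ofReal (Real.exp (-(r : ℝ)) * (r : ℝ) ^ n / (n.factorial : ℝ)) = 1 := by
    have h := hasSum_one_poissonMeasure r
    rw [← ENNReal.ofReal_tsum_of_nonneg (fun n => by positivity) h.summable, h.tsum_eq,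
      ENNReal.ofReal_one]
  rw [poissonMeasure, lintegral_sum_measure]
  simp only [lintegral_smul_measure, lintegral_dirac, smul_eq_mul]
  rw [tsum_eq_zero_add' ENNReal.summable]
  simp only [Nat.cast_zero, mul_zero, zero_add]
  rw [← mul_one (r : ℝ≥0∞), ← h1, ← ENNReal.tsum_mul_left]
  refine tsum_congr fun n => ?_
  rw [← ENNReal.ofReal_coe_nnreal, ← ENNReal.ofReal_natCast, ← ENNReal.ofReal_mul (by positivity),
    ← ENNReal.ofReal_mul (by positivity)]
  congr 1
  rw [Nat.factorial_succ]
  push_cast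
  field_simp
  ring

lemma toENNReal_count {Ω : Type*} (X : ℕ → Ω → ℝ) (B : Set ℝ) (ω : Ω) :
    ((count X B ω : ℕ∞) : ℝ≥0∞) = ∑' k, B.indicator 1 (X k ω) := by
  rw [count, ← ENNReal.tsum_set_one, tsum_subtype {k : ℕ | X k ω ∈ B} (fun _ => (1 : ℝ≥0∞))]
  rfl

lemma lintegral_count {P : Measure Ω} {lam : ℝ≥0} {X : ℕ → Ω → ℝ} (hX : IsPoissonProcess P lam X)
    {B : Set ℝ} (hB : MeasurableSet B) (hB' : volume B ≠ ∞) :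
    ∫⁻ ω, ((count X B ω : ℕ∞) : ℝ≥0∞) ∂P = lam * volume B := by
  have h := hX.count_law B hB hB'
  have hm : Measurable (fun n : ℕ∞ => (n : ℝ≥0∞)) := .of_discrete
  rw [← lintegral_map' (f := fun n : ℕ∞ => (n : ℝ≥0∞)) hm.aemeasurable h.aemeasurable, h.map_eq,
    lintegral_map hm .of_discrete]
  simp only [ENat.toENNReal_coe]
  rw [lintegral_natCast_poissonMeasure]
  push_cast
  rw [ENNReal.coe_toNNReal hB']

/-- A finite product of sums, expanded. -/
lemma prod_tsum_eq_tsum_prod {κ : Type*} (n : ℕ) (f : Fin n → κ → ℝ≥0∞) :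
    ∏ i, ∑' j, f i j = ∑' k : Fin n → κ, ∏ i, f i (k i) := by
  induction n with
  | zero => simp
  | succ n ih =>
    rw [Fin.prod_univ_succ, ih, ← (Fin.consEquiv fun _ => κ).tsum_eq, ENNReal.tsum_prod',
      ← ENNReal.tsum_mul_right]
    refine tsum_congr fun a => ?_
    rw [← ENNReal.tsum_mul_left]
    refine tsum_congr fun k => ?_
    simp [Fin.prod_univ_succ, Fin.consEquiv]

/-- The same for an arbitrary finite index type. -/
lemma prod_tsum_eq_tsum_prod' {ι κ : Type*} [Fintype ι] (f : ι → κ → ℝ≥0∞) :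
    ∏ i, ∑' j, f i j = ∑' k : ι → κ, ∏ i, f i (k i) := by
  let e := Fintype.equivFin ι
  rw [← e.symm.prod_comp, prod_tsum_eq_tsum_prod,
    ← (Equiv.arrowCongr e (Equiv.refl κ)).tsum_eq]
  refine tsum_congr fun k => ?_
  rw [← e.symm.prod_comp]
  simp [Equiv.arrowCongr]

/-! ### Separating distinct points by dyadic cells -/

/-- The dyadic cell of level `m` with index `c`. -/
def dyadicCell (m : ℕ) (c : ℤ) : Set ℝ := {x | ⌊(2 : ℝ) ^ m * x⌋ = c}

lemma measurableSet_dyadicCell (m : ℕ) (c : ℤ) : MeasurableSet (dyadicCell m c) := by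
  have : Measurable fun x : ℝ => ⌊(2 : ℝ) ^ m * x⌋ := by fun_prop
  exact this (measurableSet_singleton c)

lemma volume_dyadicCell_ne_top (m : ℕ) (c : ℤ) : volume (dyadicCell m c) ≠ ∞ := by
  have hp : (0 : ℝ) < 2 ^ m := by positivity
  have : dyadicCell m c ⊆ Set.Icc ((c : ℝ) / 2 ^ m) ((c + 1) / 2 ^ m) := by
    intro x hx
    have h := Int.floor_eq_iff.1 hx
    constructor
    · rw [div_le_iff₀ hp]; linarith
    · rw [le_div_iff₀ hp]; linarith
  exact measure_ne_top_of_subset this (by simp)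

/-- Dyadic cells are nested: `⌊z⌋` is the integer half of `⌊2 * z⌋`. -/
lemma floor_eq_of_floor_two_mul_eq {x y : ℝ} (h : ⌊2 * x⌋ = ⌊2 * y⌋) : ⌊x⌋ = ⌊y⌋ := by
  have key : ∀ z : ℝ, ⌊z⌋ = ⌊2 * z⌋ / 2 := fun z => by
    have := Int.floor_le z
    have h1 := Int.lt_floor_add_one z
    have h2 : 2 * ⌊z⌋ ≤ ⌊2 * z⌋ := by
      rw [Int.le_floor]; push_cast; linarith
    have h3 : ⌊2 * z⌋ < 2 * ⌊z⌋ + 2 := by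
      rw [Int.floor_lt]; push_cast; linarith
    omega
  rw [key x, key y, h]

/-- The configurations whose points lie in different dyadic cells of level `m`. -/
def separated (ι : Type*) (m : ℕ) : Set (ι → ℝ) :=
  {x | Function.Injective fun i => ⌊(2 : ℝ) ^ m * x i⌋}

lemma separated_mono (ι : Type*) : Monotone (separated ι) := by
  refine monotone_nat_of_le_succ fun m x hx i j hij => ?_
  refine hx ?_
  refine floor_eq_of_floor_two_mul_eq ?_
  dsimp only at hij ⊢
  rwa [← mul_assoc, ← mul_assoc, ← pow_succ']

/-- Two points have different floors at level `m` once `2 ^ m * |x i - x j| ≥ 1`; there are only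
finitely many pairs. -/
lemma iUnion_separated (ι : Type*) [Finite ι] :
    ⋃ m, separated ι m = {x : ι → ℝ | Function.Injective x} := by
  ext x
  simp only [Set.mem_iUnion, Set.mem_ofPred_eq]
  constructor
  · rintro ⟨m, hm⟩ i j hij
    exact hm (by simp [hij])
  · intro hx
    have : ∀ᶠ m : ℕ in Filter.atTop, ∀ q : ι × ι, q.1 ≠ q.2 →
        ⌊(2 : ℝ) ^ m * x q.1⌋ ≠ ⌊(2 : ℝ) ^ m * x q.2⌋ := by
      rw [Filter.eventually_all]
      rintro ⟨i, j⟩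
      by_cases hij : i = j
      · simp [hij]
      have hd : 0 < |x i - x j| := abs_pos.2 (sub_ne_zero.2 fun h => hij (hx h))
      have ht := (tendsto_pow_atTop_atTop_of_one_lt (one_lt_two (α := ℝ))).atTop_mul_const hd
      filter_upwards [ht.eventually_ge_atTop 1] with m hm _ h
      have := Int.abs_sub_lt_one_of_floor_eq_floor h
      rw [← mul_sub, abs_mul, abs_of_pos (by positivity : (0 : ℝ) < 2 ^ m)] at this
      linarith
    obtain ⟨m, hm⟩ := this.exists
    refine ⟨m, fun i j hij => ?_⟩
    by_contra hne
    exact hm (i, j) hne hij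

/-- Cutting by cells reduces arbitrary boxes to boxes with pairwise disjoint sides, the only ones on
which independence of counts gives information. -/
lemma measure_separated_inter_pi {ι : Type*} [Fintype ι] (ν : Measure (ι → ℝ)) {B : ι → Set ℝ}
    (hB : ∀ i, MeasurableSet (B i)) (m : ℕ) :
    ν (separated ι m ∩ Set.univ.pi B) =
      ∑' c : {c : ι → ℤ // Function.Injective c},
        ν (Set.univ.pi fun i => B i ∩ dyadicCell m (c.1 i)) := by
  rw [← measure_iUnion]
  · congr 1
    ext x
    simp only [separated, dyadicCell, Set.mem_inter_iff, Set.mem_ofPred_eq, Set.mem_pi,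
      Set.mem_univ, true_imp_iff, Set.mem_iUnion, Subtype.exists]
    constructor
    · rintro ⟨h1, h2⟩
      exact ⟨_, h1, fun i => ⟨h2 i, rfl⟩⟩
    · rintro ⟨c, hc, h⟩
      refine ⟨?_, fun i => (h i).1⟩
      rwa [show (fun i => ⌊(2 : ℝ) ^ m * x i⌋) = c from funext fun i => (h i).2]
  · intro c c' hcc'
    refine Set.disjoint_left.2 fun x hx hx' => hcc' (Subtype.ext (funext fun i => ?_))
    exact (hx i trivial).2.symm.trans (hx' i trivial).2
  · exact fun c => .univ_pi fun i => (hB i).inter (measurableSet_dyadicCell _ _)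

/-- A measure on a finite power of `ℝ` that does not charge the diagonals is determined by its
values on the products of pairwise disjoint sets of finite measure. -/
lemma eq_pi_of_forall_disjoint {ι : Type*} [Fintype ι] (ν : Measure (ι → ℝ)) (c : ℝ≥0)
    (hν : ∀ᵐ x ∂ν, Function.Injective x)
    (h : ∀ D : ι → Set ℝ, (∀ i, MeasurableSet (D i)) → (∀ i, volume (D i) ≠ ∞) →
      Pairwise (fun i j => Disjoint (D i) (D j)) →
      ν (Set.univ.pi D) = ∏ i, (c * volume (D i))) :
    ν = Measure.pi fun _ => c • volume := by
  set π : Measure (ι → ℝ) := Measure.pi fun _ => c • volume with hπ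
  have hπ' : ∀ᵐ x ∂π, Function.Injective x := by
    have : ∀ q : ι × ι, ∀ᵐ x ∂π, q.1 ≠ q.2 → x q.1 ≠ x q.2 := by
      rintro ⟨i, j⟩
      by_cases hij : i = j
      · simp [hij]
      -- The diagonal is the kernel of the nonzero linear form `x i - x j`, a proper subspace, hence
      -- Lebesgue null.
      have hv : ∀ᵐ x ∂(volume : Measure (ι → ℝ)), x i ≠ x j := by
        classical
        let f : (ι → ℝ) →ₗ[ℝ] ℝ := (LinearMap.proj i : (ι → ℝ) →ₗ[ℝ] ℝ) - LinearMap.proj j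
        have hne : LinearMap.ker f ≠ ⊤ := by
          intro htop
          have : f (Pi.single i 1) = 0 := by
            rw [← LinearMap.mem_ker, htop]; trivial
          simp [f, Ne.symm hij] at this
        have h0 := Measure.addHaar_submodule (volume : Measure (ι → ℝ)) _ hne
        rw [ae_iff]
        refine measure_mono_null (fun x hx => ?_) h0
        simp only [ne_eq, not_not, Set.mem_ofPred_eq] at hx
        simp [f, hx]
      have hac : π ≪ (volume : Measure (ι → ℝ)) := by
        have : π = c ^ Fintype.card ι • (volume : Measure (ι → ℝ)) := by
          refine Measure.pi_eq fun s hs => ?_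
          rw [Measure.smul_apply, volume_pi, Measure.pi_pi]
          simp only [Measure.smul_apply, ENNReal.smul_def, smul_eq_mul, Finset.prod_mul_distrib,
            Finset.prod_const, ENNReal.coe_pow, Finset.card_univ]
        rw [this]
        exact Measure.smul_absolutelyContinuous
      filter_upwards [hac.ae_le hv] with x hx _ using hx
    filter_upwards [ae_all_iff.2 this] with x hx i j hij
    by_contra hne
    exact hx (i, j) hne hij
  have hdis : ∀ D : ι → Set ℝ, (∀ i, MeasurableSet (D i)) → (∀ i, volume (D i) ≠ ∞) →
      Pairwise (fun i j => Disjoint (D i) (D j)) → ν (Set.univ.pi D) = π (Set.univ.pi D) := by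
    intro D h1 h2 h3
    rw [h D h1 h2 h3, hπ, Measure.pi_pi]
    rfl
  -- Continuity from below along the increasing separated sets, which exhaust the complement of the
  -- diagonals.
  have hlim : ∀ ρ : Measure (ι → ℝ), (∀ᵐ x ∂ρ, Function.Injective x) → ∀ B : ι → Set ℝ,
      ρ (Set.univ.pi B) = ⨆ m, ρ (separated ι m ∩ Set.univ.pi B) := by
    intro ρ hρ B
    rw [← Monotone.measure_iUnion (fun a b hab => Set.inter_subset_inter_left _
      (separated_mono ι hab)), ← Set.iUnion_inter, iUnion_separated]
    refine measure_congr ?_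
    filter_upwards [hρ] with x hx
    refine propext ⟨fun h => ⟨hx, h⟩, fun h => h.2⟩
  refine (Measure.pi_eq fun B hB => ?_).symm
  rw [← Measure.pi_pi, ← hπ, hlim ν hν, hlim π hπ']
  congr 1
  ext m
  rw [measure_separated_inter_pi _ hB, measure_separated_inter_pi _ hB]
  refine tsum_congr fun d => hdis _ (fun i => (hB i).inter (measurableSet_dyadicCell _ _))
    (fun i => measure_ne_top_of_subset Set.inter_subset_right (volume_dyadicCell_ne_top _ _)) ?_
  intro i j hij
  refine Set.disjoint_left.2 fun x hx hx' => hij (d.2 ?_)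
  exact hx.2.symm.trans hx'.2

/-- The factorial moment measures of a Poisson process are multiples of the Lebesgue measures. -/
theorem sum_map_bases {P : Measure Ω} {lam : ℝ≥0} {X : ℕ → Ω → ℝ} (hX : IsPoissonProcess P lam X)
    (ι : Type*) [Fintype ι] :
    (Measure.sum fun k : ι ↪ ℕ => P.map fun ω i => X (k i) ω) =
      Measure.pi fun _ => lam • volume := by
  have hm : ∀ k : ι ↪ ℕ, Measurable fun ω i => X (k i) ω :=
    fun k => measurable_pi_lambda _ fun i => hX.measurable _
  refine eq_pi_of_forall_disjoint _ lam ?_ ?_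
  · have : Countable (ι ↪ ℕ) := DFunLike.coe_injective.countable
    rw [Measure.ae_sum_iff]
    intro k
    refine ae_map_iff (hm k).aemeasurable ?_ |>.2 ?_
    · rw [← iUnion_separated]
      refine .iUnion fun m => ?_
      have : separated ι m = ⋂ i, ⋂ j, {x | ⌊(2 : ℝ) ^ m * x i⌋ = ⌊(2 : ℝ) ^ m * x j⌋ → i = j} := by
        ext x; simp [separated, Function.Injective]
      rw [this]
      refine .iInter fun i => .iInter fun j => ?_
      exact (measurableSet_eq_fun (by fun_prop) (by fun_prop)).imp (.const _)
    · filter_upwards [hX.simple] with ω hω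
      exact fun i j hij => k.injective (hω hij)
  · intro D hD hD' hdis
    have hcount : ∀ B, MeasurableSet B → Measurable fun ω => ((count X B ω : ℕ∞) : ℝ≥0∞) := by
      intro B hB
      simp_rw [toENNReal_count]
      exact .tsum fun k => (measurable_one.indicator hB).comp (hX.measurable k)
    have hprod : ∫⁻ ω, ∏ i, ((count X (D i) ω : ℕ∞) : ℝ≥0∞) ∂P = ∏ i, (lam * volume (D i)) := by
      have e := Fintype.equivFin ι
      have hind := hX.count_indep _ (fun i => D (e.symm i)) (fun i => hD _)
        (fun i j hij => hdis (e.symm.injective.ne hij))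
      have hind' := hind.comp (fun _ => fun n : ℕ∞ => (n : ℝ≥0∞)) (fun _ => .of_discrete)
      have := lintegral_prod_eq_prod_lintegral_of_indepFun Finset.univ _ hind'
        (fun i => hcount _ (hD _))
      simp only [Function.comp_apply] at this
      simp_rw [← e.symm.prod_comp]
      rw [this]
      exact Finset.prod_congr rfl fun i _ => lintegral_count hX (hD _) (hD' _)
    rw [← hprod, Measure.sum_apply _ (.univ_pi hD)]
    have hk : ∀ k : ι → ℕ, P.map (fun ω i => X (k i) ω) (Set.univ.pi D) =
        ∫⁻ ω, ∏ i, (D i).indicator 1 (X (k i) ω) ∂P := by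
      intro k
      have hmk : Measurable fun ω i => X (k i) ω := measurable_pi_lambda _ fun i => hX.measurable _
      rw [Measure.map_apply hmk (.univ_pi hD), ← lintegral_indicator_one (hmk (.univ_pi hD))]
      refine lintegral_congr fun ω => ?_
      classical
      simp only [Set.indicator_apply, Set.mem_preimage, Set.mem_univ_pi, Pi.one_apply,
        Finset.prod_ite_zero, Finset.prod_const_one, Finset.mem_univ, true_imp_iff]
    -- The product of counts expands into a sum over all index tuples; those with a repeated index
    -- contribute nothing, since one point cannot lie in two disjoint sets.
    simp_rw [toENNReal_count, prod_tsum_eq_tsum_prod']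
    rw [lintegral_tsum fun k => by
      refine (Finset.measurable_prod _ fun i _ => ?_).aemeasurable
      exact (measurable_one.indicator (hD i)).comp (hX.measurable _)]
    simp_rw [← hk]
    rw [← (Equiv.subtypeInjectiveEquivEmbedding ι ℕ).tsum_eq]
    refine (tsum_subtype_eq_of_support_subset
      (f := fun k : ι → ℕ => P.map (fun ω i => X (k i) ω) (Set.univ.pi D)) fun k hk' => ?_)
    by_contra hinj
    refine hk' ?_
    have hinj' : ¬ Function.Injective k := hinj
    rw [Function.Injective] at hinj'
    push Not at hinj'
    obtain ⟨i, j, hij, hne⟩ := hinj'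
    dsimp only
    rw [Measure.map_apply (measurable_pi_lambda _ fun i => hX.measurable _) (.univ_pi hD)]
    convert measure_empty (μ := P)
    refine Set.eq_empty_of_forall_notMem fun ω hω => ?_
    have h1 : X (k i) ω ∈ D i := hω i trivial
    have h2 : X (k j) ω ∈ D j := hω j trivial
    rw [← hij] at h2
    exact Set.disjoint_left.1 (hdis hne) h1 h2

end FactorialMoments

/-! ### Independent marking by heights and by the starting point -/

section MarkedMoments

variable {Ω : Type*} [MeasurableSpace Ω]

/-- The factorial moment measures of a Poisson building process, jointly with an independent
starting point. -/
theorem sum_map_buildings {P : Measure Ω} [IsProbabilityMeasure P] {lam : ℝ≥0}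
    {𝓛 : Measure ℝ≥0} [IsProbabilityMeasure 𝓛] {X : ℕ → Ω → ℝ} {H : ℕ → Ω → ℝ≥0}
    (hL : IsPoissonBuildingProcess P lam 𝓛 X H) {start : Ω → HalfPlane}
    (hstart : Measurable start) (hindep : IndepFun start (fun ω k => (X k ω, H k ω)) P)
    (ι : Type*) [Fintype ι] :
    (Measure.sum fun k : ι ↪ ℕ => P.map fun ω => (start ω, fun i => (X (k i) ω, H (k i) ω))) =
      (P.map start).prod (Measure.pi fun _ : ι => (lam • volume : Measure ℝ).prod 𝓛) := by
  have hXm := hL.bases.measurable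
  have hHm := hL.heights_measurable
  have : Countable (ι ↪ ℕ) := DFunLike.coe_injective.countable
  have : IsProbabilityMeasure (P.map start) := Measure.isProbabilityMeasure_map hstart.aemeasurable
  set e := MeasurableEquiv.arrowProdEquivProdArrow ℝ ℝ≥0 ι
  have hXk : ∀ k : ι ↪ ℕ, Measurable fun ω i => X (k i) ω :=
    fun k => measurable_pi_lambda _ fun i => hXm _
  have hHk : ∀ k : ι ↪ ℕ, Measurable fun ω i => H (k i) ω :=
    fun k => measurable_pi_lambda _ fun i => hHm _
  have hZk : ∀ k : ι ↪ ℕ, Measurable fun ω i => (X (k i) ω, H (k i) ω) :=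
    fun k => measurable_pi_lambda _ fun i => (hXm _).prodMk (hHm _)
  -- Only the law of the bases depends on `k`, so the sum over `k` can be moved onto that factor.
  -- Distinct indices make the heights i.i.d.
  have hlaw : ∀ k : ι ↪ ℕ, P.map (fun ω => (start ω, fun i => (X (k i) ω, H (k i) ω))) =
      (P.map start).prod (((P.map fun ω i => X (k i) ω).prod
        (Measure.pi fun _ => 𝓛)).map e.symm) := by
    intro k
    have h1 : IndepFun start (fun ω i => (X (k i) ω, H (k i) ω)) P :=
      hindep.comp (φ := id) (ψ := fun z : ℕ → ℝ × ℝ≥0 => fun i => z (k i)) measurable_id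
        (measurable_pi_lambda _ fun i => measurable_pi_apply _)
    rw [h1.map_prod_eq_prod_map_map hstart.aemeasurable (hZk k).aemeasurable]
    congr 1
    have h2 : IndepFun (fun ω i => X (k i) ω) (fun ω i => H (k i) ω) P :=
      hL.indep.comp (φ := fun z : ℕ → ℝ => fun i => z (k i))
        (ψ := fun z : ℕ → ℝ≥0 => fun i => z (k i))
        (measurable_pi_lambda _ fun i => measurable_pi_apply _)
        (measurable_pi_lambda _ fun i => measurable_pi_apply _)
    have h3 : P.map (fun ω i => H (k i) ω) = Measure.pi fun _ => 𝓛 := by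
      have := (hL.heights_indep.precomp k.injective)
      rw [iIndepFun_iff_map_fun_eq_pi_map (fun i => (hHm _).aemeasurable)] at this
      rw [this]
      simp [hL.heights_law]
    rw [← h3, ← h2.map_prod_eq_prod_map_map (hXk k).aemeasurable (hHk k).aemeasurable,
      Measure.map_map e.symm.measurable ((hXk k).prodMk (hHk k))]
    rfl
  simp_rw [hlaw]
  have hp : ∀ k : ι ↪ ℕ, IsProbabilityMeasure (P.map fun ω i => X (k i) ω) :=
    fun k => Measure.isProbabilityMeasure_map (hXk k).aemeasurable
  rw [← Measure.prod_sum_right, ← Measure.map_sum e.symm.measurable.aemeasurable,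
    ← Measure.prod_sum_left, sum_map_bases hL.bases]
  congr 1
  exact ((measurePreserving_arrowProdEquivProdArrow ℝ ℝ≥0 ι (fun _ => lam • volume)
    (fun _ => 𝓛)).symm).map_eq

end MarkedMoments

/-! ### Inclusion-exclusion -/

section InclusionExclusion

/-- The vanishing of the alternating sum of binomial coefficients for `n ≠ 0`, without subtraction:
by Pascal's rule the even and the odd sum of row `n + 1` both equal the full sum of row `n`. -/
lemma tsum_choose_even_eq (n : ℕ) :
    (if n = 0 then 1 else 0) + ∑' m : ℕ, (n.choose (2 * m + 1) : ℝ≥0∞) =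
      ∑' m : ℕ, (n.choose (2 * m) : ℝ≥0∞) := by
  cases n with
  | zero =>
    rw [tsum_eq_zero_add' (f := fun m : ℕ => (Nat.choose 0 (2 * m) : ℝ≥0∞)) ENNReal.summable]
    simp [Nat.mul_add]
  | succ n =>
    have h1 : ∑' m : ℕ, ((n + 1).choose (2 * m) : ℝ≥0∞) =
        ∑' m : ℕ, (n.choose (2 * m) : ℝ≥0∞) + ∑' m : ℕ, (n.choose (2 * m + 1) : ℝ≥0∞) := by
      rw [tsum_eq_zero_add' (f := fun m : ℕ => ((n + 1).choose (2 * m) : ℝ≥0∞)) ENNReal.summable,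
        tsum_eq_zero_add' (f := fun m : ℕ => (n.choose (2 * m) : ℝ≥0∞)) ENNReal.summable,
        add_assoc, ← ENNReal.tsum_add]
      congr 1
      · simp
      · refine tsum_congr fun m => ?_
        rw [show 2 * (m + 1) = (2 * m + 1) + 1 by ring, Nat.choose_succ_succ]
        push_cast
        ring
    rw [h1, ← ENNReal.tsum_add]
    simp only [Nat.add_eq_zero_iff, one_ne_zero, and_false, if_false, zero_add]
    refine tsum_congr fun m => ?_
    rw [Nat.choose_succ_succ]
    push_cast
    ring

/-- Inclusion-exclusion for the event that a type is empty. -/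
lemma tsum_embedding_even_eq (T : Type*) [Decidable (IsEmpty T)] :
    (if IsEmpty T then 1 else 0) +
        ∑' m : ℕ, ((2 * m + 1).factorial : ℝ≥0∞)⁻¹ * (ENat.card (Fin (2 * m + 1) ↪ T) : ℝ≥0∞) =
      ∑' m : ℕ, ((2 * m).factorial : ℝ≥0∞)⁻¹ * (ENat.card (Fin (2 * m) ↪ T) : ℝ≥0∞) := by
  rcases finite_or_infinite T with hT | hT
  · have := Fintype.ofFinite T
    have key : ∀ m : ℕ, (m.factorial : ℝ≥0∞)⁻¹ * (ENat.card (Fin m ↪ T) : ℝ≥0∞) =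
        ((Fintype.card T).choose m : ℝ≥0∞) := by
      intro m
      have hm0 : (m.factorial : ℝ≥0∞) ≠ 0 := by exact_mod_cast m.factorial_ne_zero
      rw [ENat.card_eq_coe_fintype_card, Fintype.card_embedding_eq, Fintype.card_fin,
        Nat.descFactorial_eq_factorial_mul_choose]
      push_cast
      rw [← mul_assoc, ENNReal.inv_mul_cancel hm0 (ENNReal.natCast_ne_top _), one_mul]
    simp_rw [key]
    rw [← tsum_choose_even_eq]
    simp [Fintype.card_eq_zero_iff]
  -- For infinite `T` both sides are `∞`. The empty tuple is unique, so the even sum needs its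
  -- second term to show this.
  · have key : ∀ m : ℕ, ((m + 1).factorial : ℝ≥0∞)⁻¹ * (ENat.card (Fin (m + 1) ↪ T) : ℝ≥0∞) =
        ∞ := by
      intro m
      have : Infinite (Fin (m + 1) ↪ T) := by
        have e := Infinite.natEmbedding T
        refine Infinite.of_injective (fun n : ℕ =>
          (⟨fun i => e (n + i), fun i j h => Fin.ext (by simpa using e.injective h)⟩ :
            Fin (m + 1) ↪ T)) fun n n' h => ?_
        have := DFunLike.congr_fun h 0
        simpa using e.injective this
      rw [ENat.card_eq_top_of_infinite, ENat.toENNReal_top]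
      exact ENNReal.mul_top (ENNReal.inv_ne_zero.2 (ENNReal.natCast_ne_top _))
    have h1 := ENNReal.le_tsum (f := fun m : ℕ => ((2 * m + 1).factorial : ℝ≥0∞)⁻¹ *
      (ENat.card (Fin (2 * m + 1) ↪ T) : ℝ≥0∞)) 0
    have h2 := ENNReal.le_tsum (f := fun m : ℕ => ((2 * m).factorial : ℝ≥0∞)⁻¹ *
      (ENat.card (Fin (2 * m) ↪ T) : ℝ≥0∞)) 1
    rw [show 2 * 0 + 1 = 0 + 1 by rfl, key] at h1
    rw [show 2 * 1 = 1 + 1 by rfl, key] at h2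
    rw [top_le_iff.1 h1, top_le_iff.1 h2, add_top]

/-- Writes a number of tuples as a sum of products of indicators, which can be integrated term by
term. -/
lemma tsum_prod_indicator_embedding {β S : Type*} (z : β → S) (V : Set S) (m : ℕ) :
    ∑' j : Fin m ↪ β, ∏ i, V.indicator (1 : S → ℝ≥0∞) (z (j i)) =
      (ENat.card (Fin m ↪ {b | z b ∈ V}) : ℝ≥0∞) := by
  rw [← ENat.card_congr (Equiv.codRestrict (Fin m) {b | z b ∈ V}), ← ENNReal.tsum_one]
  refine Eq.trans (tsum_congr fun j => ?_)
    (tsum_subtype {f : Fin m ↪ β | ∀ a, f a ∈ {b | z b ∈ V}} (fun _ => (1 : ℝ≥0∞))).symm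
  classical
  simp only [Set.indicator_apply, Pi.one_apply, Finset.prod_ite_zero, Finset.prod_const_one,
    Finset.mem_univ, true_imp_iff, Set.mem_ofPred_eq]

/-- This is `exp (-v) + sinh v = cosh v`, the counterpart for measures of `tsum_embedding_even_eq`.
-/
lemma exp_neg_add_tsum_odd {v : ℝ} (hv : 0 ≤ v) :
    ENNReal.ofReal (Real.exp (-v)) +
        ∑' m : ℕ, ((2 * m + 1).factorial : ℝ≥0∞)⁻¹ * ENNReal.ofReal v ^ (2 * m + 1) =
      ∑' m : ℕ, ((2 * m).factorial : ℝ≥0∞)⁻¹ * ENNReal.ofReal v ^ (2 * m) := by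
  have key : ∀ m : ℕ, (m.factorial : ℝ≥0∞)⁻¹ * ENNReal.ofReal v ^ m =
      ENNReal.ofReal (v ^ m / m.factorial) := by
    intro m
    rw [ENNReal.ofReal_div_of_pos (by positivity), ENNReal.ofReal_pow hv, ENNReal.ofReal_natCast,
      ENNReal.div_eq_inv_mul]
  simp_rw [key]
  rw [← ENNReal.ofReal_tsum_of_nonneg (fun m => by positivity) (Real.hasSum_sinh v).summable,
    ← ENNReal.ofReal_tsum_of_nonneg (fun m => by positivity) (Real.hasSum_cosh v).summable,
    (Real.hasSum_sinh v).tsum_eq, (Real.hasSum_cosh v).tsum_eq,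
    ← ENNReal.ofReal_add (Real.exp_nonneg _) (Real.sinh_nonneg_iff.2 hv)]
  congr 1
  rw [Real.sinh_eq, Real.cosh_eq]
  ring

lemma tsum_odd_le_exp {v : ℝ} (hv : 0 ≤ v) :
    ∑' m : ℕ, ((2 * m + 1).factorial : ℝ≥0∞)⁻¹ * ENNReal.ofReal v ^ (2 * m + 1) ≤
      ENNReal.ofReal (Real.exp v) := by
  have key : ∀ m : ℕ, (m.factorial : ℝ≥0∞)⁻¹ * ENNReal.ofReal v ^ m =
      ENNReal.ofReal (v ^ m / m.factorial) := by
    intro m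
    rw [ENNReal.ofReal_div_of_pos (by positivity), ENNReal.ofReal_pow hv, ENNReal.ofReal_natCast,
      ENNReal.div_eq_inv_mul]
  simp_rw [key]
  rw [← ENNReal.ofReal_tsum_of_nonneg (fun m => by positivity) (Real.hasSum_sinh v).summable,
    (Real.hasSum_sinh v).tsum_eq]
  refine ENNReal.ofReal_le_ofReal ?_
  rw [Real.sinh_eq]
  have := Real.exp_pos v
  have := Real.exp_pos (-v)
  linarith

variable {Ω S₀ S : Type*} [MeasurableSpace Ω] [MeasurableSpace S₀] [MeasurableSpace S]

/-- The integrals of the products of a function of a first group of points with the number of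
`m`-tuples of further points in a set that depends on the first group. -/
lemma lintegral_tsum_embedding {P : Measure Ω} {ν : Measure S₀} [SFinite ν] {Λ : Measure S}
    [SigmaFinite Λ] {s : Ω → S₀} (hs : Measurable s) {Z : ℕ → Ω → S} (hZ : ∀ k, Measurable (Z k))
    {ι : Type} [Fintype ι] (m : ℕ)
    (hmom : (Measure.sum fun k : ι ⊕ Fin m ↪ ℕ => P.map fun ω => (s ω, fun i => Z (k i) ω)) =
      ν.prod (Measure.pi fun _ => Λ))
    {f : S₀ × (ι → S) → ℝ≥0∞} (hf : Measurable f) {V : Set ((S₀ × (ι → S)) × S)}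
    (hV : MeasurableSet V) :
    ∑' k : ι ↪ ℕ, ∫⁻ ω, f (s ω, fun i => Z (k i) ω) *
        ENat.card (Fin m ↪ {j : ↥(Set.range k)ᶜ | ((s ω, fun i => Z (k i) ω), Z j ω) ∈ V}) ∂P =
      ∫⁻ p, f p * Λ (Prod.mk p ⁻¹' V) ^ m ∂(ν.prod (Measure.pi fun _ => Λ)) := by
  have hcount : Countable (ι ↪ ℕ) := DFunLike.coe_injective.countable
  have hcount' : ∀ k : ι ↪ ℕ, Countable (Fin m ↪ ↥(Set.range k)ᶜ) :=
    fun k => DFunLike.coe_injective.countable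
  let φ : S₀ × (ι ⊕ Fin m → S) → ℝ≥0∞ := fun q => f (q.1, fun i => q.2 (.inl i)) *
    ∏ i, V.indicator 1 ((q.1, fun i => q.2 (.inl i)), q.2 (.inr i))
  have hφ : Measurable φ := by
    refine (hf.comp (by fun_prop)).mul (Finset.measurable_prod _ fun i _ => ?_)
    exact (measurable_one.indicator hV).comp (by fun_prop)
  have hZm : ∀ k : ι ⊕ Fin m ↪ ℕ, Measurable fun ω => (s ω, fun i => Z (k i) ω) :=
    fun k => hs.prodMk (measurable_pi_lambda _ fun i => hZ _)
  -- An injective tuple indexed by `ι ⊕ Fin m` is an injective tuple `k` followed by an injective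
  -- tuple avoiding the range of `k`.
  calc _ = ∑' k : ι ↪ ℕ, ∑' j : Fin m ↪ ↥(Set.range k)ᶜ, ∫⁻ ω, φ (s ω, fun i =>
            Z (Equiv.sumEmbeddingEquivSigmaEmbeddingRestricted.symm
              (⟨k, j⟩ : Σ f : ι ↪ ℕ, Fin m ↪ ↥(Set.range f)ᶜ) i) ω) ∂P := by
        refine tsum_congr fun k => ?_
        refine Eq.trans (lintegral_congr fun ω => ?_)
          (lintegral_tsum fun j => (hφ.comp (hZm _)).aemeasurable)
        have := tsum_prod_indicator_embedding
          (fun j : ↥(Set.range k)ᶜ => ((s ω, fun i => Z (k i) ω), Z j ω)) V m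
        rw [← this, ← ENNReal.tsum_mul_left]
        rfl
    _ = ∫⁻ q, φ q ∂(ν.prod (Measure.pi fun _ => Λ)) := by
        rw [← hmom, lintegral_sum_measure,
          ← Equiv.sumEmbeddingEquivSigmaEmbeddingRestricted.symm.tsum_eq, ENNReal.tsum_sigma']
        refine tsum_congr fun k => tsum_congr fun j => ?_
        rw [lintegral_map hφ (hZm _)]
    _ = _ := by
        rw [lintegral_prod _ hφ.aemeasurable, lintegral_prod]
        · refine lintegral_congr fun a => ?_
          rw [← (measurePreserving_sumPiEquivProdPi_symm
            (fun _ : ι ⊕ Fin m => Λ)).lintegral_comp_emb (MeasurableEquiv.measurableEmbedding _),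
            lintegral_prod]
          · refine lintegral_congr fun z => ?_
            have hVz : MeasurableSet (Prod.mk (a, z) ⁻¹' V) := measurable_prodMk_left hV
            change ∫⁻ y : Fin m → S, f (a, z) *
              ∏ i, V.indicator 1 ((a, z), y i) ∂(Measure.pi fun _ => Λ) = _
            rw [lintegral_const_mul]
            · congr 1
              have : (fun y : Fin m → S => ∏ i, V.indicator (1 : (S₀ × (ι → S)) × S → ℝ≥0∞) ((a, z), y i)) =
                  (Set.univ.pi fun _ => Prod.mk (a, z) ⁻¹' V).indicator 1 := by
                ext y
                classical
                simp only [Set.indicator_apply, Pi.one_apply, Finset.prod_ite_zero,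
                  Finset.prod_const_one, Finset.mem_univ, true_imp_iff, Set.mem_univ_pi,
                  Set.mem_preimage]
              rw [this, lintegral_indicator_one (.univ_pi fun _ => hVz), Measure.pi_pi]
              simp
            · refine Finset.measurable_prod _ fun i _ => ?_
              exact (measurable_one.indicator hV).comp (by fun_prop)
          · exact (hφ.comp (measurable_prodMk_left.comp
              (MeasurableEquiv.measurable _))).aemeasurable
        · exact (hf.mul ((measurable_measure_prodMk_left hV).pow_const m)).aemeasurable

open Classical in
/-- If the factorial moment measures of the points `Z k` (jointly with `s`) are those of a Poisson
process with intensity measure `Λ`, then sums over tuples of points subject to the condition that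
no other point lies in some set are given by the Mecke formula. -/
theorem tsum_lintegral_void {P : Measure Ω} {ν : Measure S₀} [SFinite ν] {Λ : Measure S}
    [SigmaFinite Λ] {s : Ω → S₀} (hs : Measurable s) {Z : ℕ → Ω → S} (hZ : ∀ k, Measurable (Z k))
    {ι : Type} [Fintype ι]
    (hmom : ∀ m : ℕ,
      (Measure.sum fun k : ι ⊕ Fin m ↪ ℕ => P.map fun ω => (s ω, fun i => Z (k i) ω)) =
        ν.prod (Measure.pi fun _ => Λ))
    {f : S₀ × (ι → S) → ℝ≥0∞} (hf : Measurable f) {V : Set ((S₀ × (ι → S)) × S)}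
    (hV : MeasurableSet V) {v : S₀ × (ι → S) → ℝ} (hv : Measurable v) (hv0 : ∀ p, f p ≠ 0 → 0 ≤ v p)
    (hΛ : ∀ p, f p ≠ 0 → Λ (Prod.mk p ⁻¹' V) = ENNReal.ofReal (v p))
    (hfin : ∫⁻ p, f p * ENNReal.ofReal (Real.exp (v p)) ∂(ν.prod (Measure.pi fun _ => Λ)) ≠ ∞) :
    ∑' k : ι ↪ ℕ, ∫⁻ ω, f (s ω, fun i => Z (k i) ω) *
        (if ∀ j ∉ Set.range k, ((s ω, fun i => Z (k i) ω), Z j ω) ∉ V then 1 else 0) ∂P =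
      ∫⁻ p, f p * ENNReal.ofReal (Real.exp (-v p)) ∂(ν.prod (Measure.pi fun _ => Λ)) := by
  set π := ν.prod (Measure.pi fun _ : ι => Λ) with hπ
  let E : (ι ↪ ℕ) → ℕ → Ω → ℝ≥0∞ := fun k m ω =>
    ENat.card (Fin m ↪ {j : ↥(Set.range k)ᶜ | ((s ω, fun i => Z (k i) ω), Z j ω) ∈ V})
  have hcount' : ∀ (k : ι ↪ ℕ) m, Countable (Fin m ↪ ↥(Set.range k)ᶜ) :=
    fun k m => DFunLike.coe_injective.countable
  have hZm : ∀ k : ι ↪ ℕ, Measurable fun ω => (s ω, fun i => Z (k i) ω) :=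
    fun k => hs.prodMk (measurable_pi_lambda _ fun i => hZ _)
  have hE : ∀ k m, Measurable (E k m) := by
    intro k m
    have : E k m = fun ω => ∑' j : Fin m ↪ ↥(Set.range k)ᶜ,
        ∏ i, V.indicator 1 ((s ω, fun i => Z (k i) ω), Z (j i) ω) := by
      ext ω
      exact (tsum_prod_indicator_embedding
          (fun j : ↥(Set.range k)ᶜ => ((s ω, fun i => Z (k i) ω), Z j ω)) V m).symm
    rw [this]
    refine .tsum fun j => Finset.measurable_prod _ fun i _ => ?_
    exact (measurable_one.indicator hV).comp ((hZm k).prodMk (hZ _))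
  have hFE : ∀ k m, Measurable fun ω => f (s ω, fun i => Z (k i) ω) * E k m ω :=
    fun k m => (hf.comp (hZm k)).mul (hE k m)
  have hVm : ∀ m : ℕ, Measurable fun p => f p * Λ (Prod.mk p ⁻¹' V) ^ m :=
    fun m => hf.mul ((measurable_measure_prodMk_left hV).pow_const m)
  -- Stated for a general choice `g` of tuple lengths, to be used for the odd and for the even ones.
  have hc : ∀ g : ℕ → ℕ,
      ∑' k : ι ↪ ℕ, ∫⁻ ω, f (s ω, fun i => Z (k i) ω) *
        ∑' m, ((g m).factorial : ℝ≥0∞)⁻¹ * E k (g m) ω ∂P =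
      ∫⁻ p, f p * ∑' m, ((g m).factorial : ℝ≥0∞)⁻¹ * Λ (Prod.mk p ⁻¹' V) ^ (g m) ∂π := by
    intro g
    have h1 : ∀ k : ι ↪ ℕ, ∫⁻ ω, f (s ω, fun i => Z (k i) ω) *
          ∑' m, ((g m).factorial : ℝ≥0∞)⁻¹ * E k (g m) ω ∂P =
        ∑' m, ((g m).factorial : ℝ≥0∞)⁻¹ *
          ∫⁻ ω, f (s ω, fun i => Z (k i) ω) * E k (g m) ω ∂P := by
      intro k
      simp_rw [← lintegral_const_mul _ (hFE k _), ← ENNReal.tsum_mul_left]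
      rw [lintegral_tsum fun m => by
        simp_rw [mul_left_comm]
        exact ((hFE k _).const_mul _).aemeasurable]
      simp_rw [mul_left_comm]
    simp_rw [h1]
    rw [ENNReal.tsum_comm]
    simp_rw [ENNReal.tsum_mul_left]
    have h2 := fun m => lintegral_tsum_embedding hs hZ m (hmom m) hf hV
    simp_rw [E, h2, ← lintegral_const_mul _ (hVm _)]
    rw [← lintegral_tsum fun m => ((hVm _).const_mul _).aemeasurable]
    refine lintegral_congr fun p => ?_
    rw [← ENNReal.tsum_mul_left]
    exact tsum_congr fun m => mul_left_comm _ _ _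
  have hΩ : ∑' k : ι ↪ ℕ, ∫⁻ ω, f (s ω, fun i => Z (k i) ω) *
        (if ∀ j ∉ Set.range k, ((s ω, fun i => Z (k i) ω), Z j ω) ∉ V then 1 else 0) ∂P +
      ∑' k : ι ↪ ℕ, ∫⁻ ω, f (s ω, fun i => Z (k i) ω) *
        ∑' m, ((2 * m + 1).factorial : ℝ≥0∞)⁻¹ * E k (2 * m + 1) ω ∂P =
      ∑' k : ι ↪ ℕ, ∫⁻ ω, f (s ω, fun i => Z (k i) ω) *
        ∑' m, ((2 * m).factorial : ℝ≥0∞)⁻¹ * E k (2 * m) ω ∂P := by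
    rw [← ENNReal.tsum_add]
    refine tsum_congr fun k => ?_
    rw [← lintegral_add_right]
    · refine lintegral_congr fun ω => ?_
      rw [← mul_add, ← tsum_embedding_even_eq
        {j : ↥(Set.range k)ᶜ | ((s ω, fun i => Z (k i) ω), Z j ω) ∈ V}]
      have hiff : (∀ j ∉ Set.range k, ((s ω, fun i => Z (k i) ω), Z j ω) ∉ V) ↔
          IsEmpty {j : ↥(Set.range k)ᶜ | ((s ω, fun i => Z (k i) ω), Z j ω) ∈ V} :=
        ⟨fun h => ⟨fun j => h j.1 j.1.2 j.2⟩, fun h j hj hjV => h.elim ⟨⟨j, hj⟩, hjV⟩⟩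
      simp only [hiff, E]
    · exact (hf.comp (hZm k)).mul (.tsum fun m => (hE k _).const_mul _)
  have hp : ∫⁻ p, f p * ENNReal.ofReal (Real.exp (-v p)) ∂π +
      ∫⁻ p, f p * ∑' m, ((2 * m + 1).factorial : ℝ≥0∞)⁻¹ *
        Λ (Prod.mk p ⁻¹' V) ^ (2 * m + 1) ∂π =
      ∫⁻ p, f p * ∑' m, ((2 * m).factorial : ℝ≥0∞)⁻¹ * Λ (Prod.mk p ⁻¹' V) ^ (2 * m) ∂π := by
    have hm : Measurable fun p => f p * ENNReal.ofReal (Real.exp (-v p)) := by fun_prop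
    rw [← lintegral_add_left hm]
    refine lintegral_congr fun p => ?_
    by_cases hfp : f p = 0
    · simp [hfp]
    · rw [← mul_add, hΛ p hfp, exp_neg_add_tsum_odd (hv0 p hfp)]
  have hodd : ∫⁻ p, f p * ∑' m, ((2 * m + 1).factorial : ℝ≥0∞)⁻¹ *
      Λ (Prod.mk p ⁻¹' V) ^ (2 * m + 1) ∂π ≠ ∞ := by
    refine ne_top_of_le_ne_top hfin (lintegral_mono fun p => ?_)
    by_cases hfp : f p = 0
    · simp [hfp]
    · dsimp only
      rw [hΛ p hfp]
      gcongr
      exact tsum_odd_le_exp (hv0 p hfp)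
  -- Both identities now share the odd sum; it is finite and cancels, leaving the void term against
  -- the exponential.
  rw [hc (fun m => 2 * m + 1), hc (fun m => 2 * m), ← hp] at hΩ
  exact (ENNReal.add_left_inj hodd).1 hΩ

end InclusionExclusion

/-! ### Blockage paths in a fixed landscape -/

section Paths

lemma slope_lt_iff {p q : HalfPlane} (h : p.1 < q.1) (t : ℝ) :
    slope p q < t ↔ (q.2 : ℝ) < p.2 + t * (q.1 - p.1) := by
  rw [slope, div_lt_iff₀ (sub_pos.2 h)]
  constructor <;> intro h' <;> linarith

lemma le_slope_iff {p q : HalfPlane} (h : p.1 < q.1) (t : ℝ) :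
    t ≤ slope p q ↔ p.2 + t * (q.1 - p.1) ≤ (q.2 : ℝ) := by
  rw [← not_lt, slope_lt_iff h, not_lt]

lemma height_eq_add_slope_mul {p q : HalfPlane} (h : p.1 < q.1) :
    (q.2 : ℝ) = p.2 + slope p q * (q.1 - p.1) := by
  rw [slope, div_mul_cancel₀ _ (sub_pos.2 h).ne']
  ring

/-- Both inequalities say that `r` lies strictly below the line through `p` and `q`. -/
lemma slope_lt_slope_iff {p q r : HalfPlane} (hpq : p.1 < q.1) (hqr : q.1 < r.1) :
    slope p r < slope p q ↔ slope q r < slope p q := by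
  rw [slope_lt_iff (hpq.trans hqr), slope_lt_iff hqr, height_eq_add_slope_mul hpq]
  constructor <;> intro h <;> linarith

variable {N : ℕ} (p : Fin (N + 1) → HalfPlane)

/-- The buildings that prevent the configuration `p` from being a blockage path. -/
def forbidden (R : ℝ) : Set HalfPlane :=
  {q | ∃ n ∈ Finset.Icc 1 N, q.1 ∈ Set.Ioc (xAt p (n - 1)) (xAt p (n - 1) + R) ∧
    tAt p n ≤ slope (pt p (n - 1)) q}

/-- The configuration `p` is a blockage path in the landscape `L`. -/
def IsPath (R : ℝ) (L : Set HalfPlane) : Prop :=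
  ∀ n ∈ Finset.Icc 1 N, IsBlocking R L (pt p (n - 1)) (pt p n)

lemma pt_zero : pt p 0 = p 0 := by
  simp [pt]

lemma pt_coe (n : Fin (N + 1)) : pt p n = p n := by
  rw [pt]
  congr
  exact min_eq_left (by omega)

variable {p}

lemma xAt_strictMono {R : ℝ}
    (h : ∀ i ∈ Finset.Icc 1 N, xAt p i ∈ Set.Ioc (xAt p (i - 1)) (xAt p (i - 1) + R)) {i j : ℕ}
    (hij : i < j) (hj : j ≤ N) : xAt p i < xAt p j := by
  induction j, hij using Nat.le_induction with
  | base => simpa using (h (i + 1) (by simp; omega)).1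
  | succ j hij ih =>
    have h1 := (h (j + 1) (by simp; omega)).1
    simp only [Nat.add_sub_cancel] at h1
    exact (ih (by omega)).trans h1

/-- The constraints on consecutive triples suffice for all later points in range. By induction on `l
- i`, the point `l` lies below the line of slope `tAt p (i + 1)` through point `i`; since `x_{i+1}`
is also in range of point `i - 1`, that slope is less than `tAt p i`. -/
lemma Admissible.slope_lt {R : ℝ} (h : Admissible p R) {i : ℕ} (hi : 1 ≤ i) {l : ℕ} (hil : i < l)
    (hl : l ≤ N) (hx : xAt p l ≤ xAt p (i - 1) + R) :
    slope (pt p (i - 1)) (pt p l) < tAt p i := by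
  have hmono := fun {i j : ℕ} => xAt_strictMono h.1 (i := i) (j := j)
  have hx1 : xAt p (i - 1) < xAt p i := hmono (by omega) (by omega)
  have hx2 : xAt p i < xAt p l := hmono hil hl
  refine (slope_lt_slope_iff hx1 hx2).2 ?_
  have ht : ∀ i, 1 ≤ i → i < N → xAt p (i + 1) ≤ xAt p (i - 1) + R → tAt p (i + 1) < tAt p i := by
    intro i hi hiN hxi
    refine (h.2 (i + 1) (by simp; omega)).resolve_right (not_lt.2 ?_)
    rwa [show i + 1 - 2 = i - 1 by omega]
  obtain ⟨d, rfl⟩ : ∃ d, l = i + 1 + d := ⟨l - (i + 1), by omega⟩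
  induction d generalizing i with
  | zero => exact ht i hi (by omega) (by simpa using hx)
  | succ d ih =>
    have hx3 : xAt p (i + 1) < xAt p (i + 1 + (d + 1)) := hmono (by omega) hl
    refine lt_trans ?_ (ht i hi (by omega) (hx3.le.trans hx))
    refine (slope_lt_slope_iff (q := pt p (i + 1)) (hmono (by omega) (by omega)) hx3).2 ?_
    have := ih (i := i + 1) (by omega)
    rw [show i + 1 + 1 + d = i + 1 + (d + 1) by omega] at this
    exact this (hmono (by omega) (by omega)) (by omega) hl
      (by simp only [Nat.add_sub_cancel]; linarith) hx3

/-- In a landscape with different bases, a configuration is a blockage path if and only if it is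
admissible and no other building is forbidden. -/
lemma isPath_iff {R : ℝ} {Z : ℕ → HalfPlane} (hZ : Function.Injective fun j => (Z j).1)
    (s : HalfPlane) (k : Fin N → ℕ) (hp : p = Fin.cons s fun i => Z (k i)) :
    IsPath p R (Set.range Z) ↔
      Admissible p R ∧ ∀ j ∉ Set.range k, Z j ∉ forbidden p R := by
  have hpt : ∀ n ∈ Finset.Icc 1 N, ∃ i : Fin N, i.1 + 1 = n ∧ pt p n = Z (k i) := by
    intro n hn
    rw [Finset.mem_Icc] at hn
    refine ⟨⟨n - 1, by omega⟩, by simp only; omega, ?_⟩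
    have := pt_coe p (⟨n - 1, by omega⟩ : Fin N).succ
    rw [hp, Fin.cons_succ, ← hp] at this
    rw [← this]
    congr 1
    simp only [Fin.succ_mk]
    omega
  constructor
  · intro h
    have hrange : ∀ i ∈ Finset.Icc 1 N,
        xAt p i ∈ Set.Ioc (xAt p (i - 1)) (xAt p (i - 1) + R) := fun i hi => (h i hi).2.1
    refine ⟨⟨hrange, fun i hi => ?_⟩, ?_⟩
    · rw [or_iff_not_imp_right, not_lt]
      intro hx
      -- In this case point `i` is visible from point `i - 2` and competes there with point `i - 1`,
      -- which wins.
      have hi' := Finset.mem_Icc.1 hi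
      have hx1 : xAt p (i - 2) < xAt p (i - 1) := xAt_strictMono hrange (by omega) (by omega)
      have hx2 : xAt p (i - 1) < xAt p i := xAt_strictMono hrange (by omega) (by omega)
      have hb := h (i - 1) (by simp; omega)
      rw [show i - 1 - 1 = i - 2 by omega] at hb
      have hlt := hb.2.2 (pt p i) (h i (by simp; omega)).1 ⟨hx1.trans hx2, hx⟩
        (fun he => hx2.ne' (congrArg Prod.fst he))
      rw [slope_lt_slope_iff hx1 hx2] at hlt
      rwa [tAt, tAt, show i - 1 - 1 = i - 2 by omega]
    · rintro j hj ⟨n, hn, hjr, hjs⟩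
      obtain ⟨i, -, hi⟩ := hpt n hn
      refine not_lt.2 hjs ((h n hn).2.2 (Z j) ⟨j, rfl⟩ hjr fun he => hj ⟨i, ?_⟩)
      rw [hi] at he
      exact hZ (congrArg Prod.fst he.symm)
  · rintro ⟨hadm, h⟩ n hn
    obtain ⟨i, -, hi⟩ := hpt n hn
    refine ⟨⟨k i, hi.symm⟩, hadm.1 n hn, ?_⟩
    rintro _ ⟨j, rfl⟩ hjr hne
    -- Competitors on the path itself are either earlier, hence not to the right of the observer, or
    -- later, hence beaten by admissibility. All others are excluded by the void condition.
    by_cases hj : j ∈ Set.range k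
    · obtain ⟨i', rfl⟩ := hj
      have hi' : pt p (i'.1 + 1) = Z (k i') := by
        obtain ⟨i'', h1, h2⟩ := hpt (i'.1 + 1) (by simp)
        rw [h2, show i'' = i' from Fin.ext (by omega)]
      rw [← hi'] at hjr hne ⊢
      have hn' := Finset.mem_Icc.1 hn
      have hlt : n < i'.1 + 1 := by
        rcases lt_trichotomy n (i'.1 + 1) with hl | hl | hl
        · exact hl
        · exact absurd (by rw [hl]) hne
        · have : xAt p (i'.1 + 1) ≤ xAt p (n - 1) := by
            rcases (show i'.1 + 1 ≤ n - 1 by omega).eq_or_lt with he | hl'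
            · rw [he]
            · exact (xAt_strictMono hadm.1 hl' (by omega)).le
          exact absurd hjr.1 (not_lt.2 this)
      exact hadm.slope_lt hn'.1 hlt (by omega) hjr.2
    · exact not_le.1 fun hle => h j hj ⟨n, hn, hjr, hle⟩

lemma IsBlocking.unique {R : ℝ} {L : Set HalfPlane} {a q q' : HalfPlane} (h : IsBlocking R L a q)
    (h' : IsBlocking R L a q') : q = q' := by
  by_contra hne
  exact lt_asymm (h.2.2 q' h'.1 h'.2.1 (Ne.symm hne)) (h'.2.2 q h.1 h.2.1 hne)

lemma blocking_eq_some_iff {R : ℝ} {L : Set HalfPlane} {a q : HalfPlane} :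
    blocking R L a = some q ↔ IsBlocking R L a q := by
  unfold blocking
  split_ifs with h
  · rw [Option.some_inj]
    exact ⟨fun he => he ▸ h.choose_spec, fun hq => h.choose_spec.unique hq⟩
  · simp only [false_iff]
    exact fun hq => h ⟨q, hq⟩

lemma IsPath.blockageSeq_eq {R : ℝ} {L : Set HalfPlane} (h : IsPath p R L) {n : ℕ} (hn : n ≤ N) :
    blockageSeq R L (p 0) n = some (pt p n) := by
  induction n with
  | zero => rw [blockageSeq, pt_zero]
  | succ n ih =>
    rw [blockageSeq, ih (by omega), Option.bind_some, blocking_eq_some_iff]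
    simpa using h (n + 1) (by simp; omega)

lemma isPath_of_isSome {R : ℝ} {L : Set HalfPlane} {s : HalfPlane}
    (h : ∀ n ≤ N, (blockageSeq R L s n).isSome) :
    IsPath (fun n : Fin (N + 1) => (blockageSeq R L s n).getD (0, 0)) R L := by
  intro n hn
  rw [Finset.mem_Icc] at hn
  obtain ⟨m, rfl⟩ : ∃ m, n = m + 1 := ⟨n - 1, by omega⟩
  obtain ⟨a, ha⟩ := Option.isSome_iff_exists.1 (h m (by omega))
  obtain ⟨b, hb⟩ := Option.isSome_iff_exists.1 (h (m + 1) (by omega))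
  have h1 : min m N = m := by omega
  have h2 : min (m + 1) N = m + 1 := by omega
  simp only [pt, Nat.add_sub_cancel, h1, h2, ha, hb, Option.getD_some]
  rw [blockageSeq, ha, Option.bind_some] at hb
  exact blocking_eq_some_iff.1 hb

end Paths

/-! ### The expanded form of the exponent -/

/-- Since `h_{i-1} + ℓ_i t_i = h_i` for `i < N`, the two forms differ termwise by increments of `𝔉
(h_i) / t_{i+1}`, which telescope. -/
lemma exponent_eq_expandedExponent {N : ℕ} (hN : 1 ≤ N) (𝓛 : Measure ℝ≥0) (R : ℝ)
    (p : Fin (N + 1) → HalfPlane)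
    (h : ∀ i ∈ Finset.Icc 1 N, xAt p (i - 1) < xAt p i ∧ tAt p i ≠ 0) :
    exponent p 𝓛 R = expandedExponent p 𝓛 R := by
  set 𝔉 := tailPrimitive 𝓛 with h𝔉
  obtain ⟨M, rfl⟩ : ∃ M, N = M + 1 := ⟨N - 1, by omega⟩
  have hx : ∀ i < M, xAt p i < xAt p (i + 1) := fun i hi => by
    simpa using (h (i + 1) (by simp; omega)).1
  have ht : ∀ i ≤ M, tAt p (i + 1) ≠ 0 := fun i hi => (h (i + 1) (by simp; omega)).2
  have hh : ∀ i < M, hAt p i + (xAt p (i + 1) - xAt p i) * tAt p (i + 1) = hAt p (i + 1) :=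
    fun i hi => by
      have := height_eq_add_slope_mul (p := pt p i) (q := pt p (i + 1)) (hx i hi)
      rw [hAt, hAt, this, tAt, Nat.add_sub_cancel, mul_comm]
      rfl
  have hq : ∀ a r t : ℝ, t ≠ 0 → quotient 𝓛 a r t = 𝔉 (a + r * t) / t - 𝔉 a / t :=
    fun a r t ht => by rw [quotient, if_neg ht, ← sub_div]
  -- The telescoping identity: one sum split at its last and at its first term.
  have hD := (Finset.sum_range_succ (fun i => 𝔉 (hAt p i) / tAt p (i + 1)) M).symm.trans
    (Finset.sum_range_succ' (fun i => 𝔉 (hAt p i) / tAt p (i + 1)) M)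
  rw [exponent, expandedExponent, Finset.sum_Icc_succ_top (by omega),
    ← Finset.Ico_add_one_right_eq_Icc]
  simp only [Finset.sum_Ico_eq_sum_range, Nat.add_sub_cancel, if_true, add_comm 1]
  rw [hq _ _ _ (ht M le_rfl)]
  have key : ∀ i ∈ Finset.range M,
      quotient 𝓛 (hAt p i) (if i + 1 = M + 1 then R else xAt p (i + 1) - xAt p i) (tAt p (i + 1)) +
        (quotient 𝓛 (hAt p (i + 1)) (rAt p R (i + 1)) (min (tAt p (i + 1)) (tAt p (i + 1 + 1))) -
          quotient 𝓛 (hAt p (i + 1)) (rAt p R (i + 1)) (tAt p (i + 1 + 1))) =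
      𝔉 (hAt p (i + 1)) * (1 / tAt p (i + 1) - 1 / min (tAt p (i + 1)) (tAt p (i + 1 + 1))) +
        (𝔉 (hAt p (i + 1) + rAt p R (i + 1) * min (tAt p (i + 1)) (tAt p (i + 1 + 1))) /
          min (tAt p (i + 1)) (tAt p (i + 1 + 1)) -
        𝔉 (hAt p (i + 1) + rAt p R (i + 1) * tAt p (i + 1 + 1)) / tAt p (i + 1 + 1)) +
      (𝔉 (hAt p (i + 1)) / tAt p (i + 1 + 1) - 𝔉 (hAt p i) / tAt p (i + 1)) := by
    intro i hi
    rw [Finset.mem_range] at hi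
    have hmin : min (tAt p (i + 1)) (tAt p (i + 1 + 1)) ≠ 0 := by
      rcases min_choice (tAt p (i + 1)) (tAt p (i + 1 + 1)) with he | he <;> rw [he]
      exacts [ht i hi.le, ht (i + 1) hi]
    rw [if_neg (by omega), hq _ _ _ (ht i hi.le), hq _ _ _ hmin, hq _ _ _ (ht (i + 1) hi),
      hh i hi]
    ring
  have hsum := Finset.sum_congr rfl key
  simp only [Finset.sum_add_distrib, Finset.sum_sub_distrib] at hsum hD ⊢
  linarith

/-! ### The measure of the set of forbidden buildings -/

section Exponent

variable {𝓛 : Measure ℝ≥0} [IsProbabilityMeasure 𝓛]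

/-- The probability that a height is at least `u`. -/
def tailGE (𝓛 : Measure ℝ≥0) (u : ℝ) : ℝ := 𝓛.real {h : ℝ≥0 | u ≤ (h : ℝ)}

lemma antitone_tailGE (𝓛 : Measure ℝ≥0) [IsProbabilityMeasure 𝓛] : Antitone (tailGE 𝓛) :=
  fun _ _ hab => measureReal_mono fun _ hh => hab.trans hh

lemma one_sub_heightCDF (𝓛 : Measure ℝ≥0) [IsProbabilityMeasure 𝓛] (u : ℝ) :
    1 - heightCDF 𝓛 u = 𝓛.real {h : ℝ≥0 | u < (h : ℝ)} := by
  rw [heightCDF, ← probReal_compl_eq_one_sub]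
  · congr 1
    ext h
    simp
  · exact measurableSet_le (by fun_prop) (by fun_prop)

/-- The tails with `<` and with `≤` differ only at atoms of `𝓛`, of which there are countably many.
-/
lemma one_sub_heightCDF_ae_eq (𝓛 : Measure ℝ≥0) [IsProbabilityMeasure 𝓛] :
    (fun u => 1 - heightCDF 𝓛 u) =ᵐ[volume] tailGE 𝓛 := by
  filter_upwards [meas_le_ae_eq_meas_lt 𝓛 volume (fun h : ℝ≥0 => (h : ℝ))] with u hu
  rw [one_sub_heightCDF, tailGE, measureReal_def, measureReal_def]
  exact congrArg ENNReal.toReal hu.symm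

lemma antitone_one_sub_heightCDF (𝓛 : Measure ℝ≥0) [IsProbabilityMeasure 𝓛] :
    Antitone fun u => 1 - heightCDF 𝓛 u := by
  intro a b hab
  dsimp only
  rw [one_sub_heightCDF, one_sub_heightCDF]
  exact measureReal_mono fun _ hh => hab.trans_lt hh

/-- On `]0, ∞[` the layer-cake formula gives the mean of `𝓛`; on compact intervals a monotone
function is integrable. -/
lemma integrableOn_one_sub_heightCDF (hmean : Integrable (fun h : ℝ≥0 => (h : ℝ)) 𝓛) (y : ℝ) :
    IntegrableOn (fun u => 1 - heightCDF 𝓛 u) (Set.Ioi y) := by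
  have h0 : IntegrableOn (fun u => 1 - heightCDF 𝓛 u) (Set.Ioi 0) := by
    refine ⟨(antitone_one_sub_heightCDF 𝓛).measurable.aestronglyMeasurable, ?_⟩
    have h1 := lintegral_eq_lintegral_meas_lt 𝓛 (f := fun h : ℝ≥0 => (h : ℝ))
      (.of_forall fun h => h.2) (by fun_prop)
    rw [hasFiniteIntegral_iff_ofReal (.of_forall fun u => by
      change 0 ≤ 1 - heightCDF 𝓛 u; rw [one_sub_heightCDF]; exact measureReal_nonneg)]
    have h2 : ∀ u : ℝ, ENNReal.ofReal (1 - heightCDF 𝓛 u) = 𝓛 {h : ℝ≥0 | u < (h : ℝ)} :=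
      fun u => by rw [one_sub_heightCDF, ofReal_measureReal]
    simp_rw [h2]
    rw [← h1]
    exact (hasFiniteIntegral_iff_ofReal (.of_forall fun h => h.2)).1 hmean.2
  have h1 : IntegrableOn (fun u => 1 - heightCDF 𝓛 u) (Set.Icc y 0) :=
    ((antitone_one_sub_heightCDF 𝓛).antitoneOn _).integrableOn_isCompact isCompact_Icc
  refine (h1.union h0).mono_set fun u hu => ?_
  rcases le_or_gt u 0 with hu0 | hu0
  · exact Or.inl ⟨le_of_lt hu, hu0⟩
  · exact Or.inr hu0

lemma monotone_tailPrimitive (hmean : Integrable (fun h : ℝ≥0 => (h : ℝ)) 𝓛) :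
    Monotone (tailPrimitive 𝓛) := by
  intro a b hab
  refine neg_le_neg (setIntegral_mono_set (integrableOn_one_sub_heightCDF hmean a) ?_
    (Set.Ioi_subset_Ioi hab).eventuallyLE)
  refine .of_forall fun u => ?_
  dsimp only
  rw [one_sub_heightCDF]
  exact measureReal_nonneg

/-- A formula uniform in `t`: the substitution `u = y + t * s` covers `t ≠ 0`, and at `t = 0` the
integrand is constant. The closed tail matches the convention that ties also block. -/
lemma quotient_eq_integral (hmean : Integrable (fun h : ℝ≥0 => (h : ℝ)) 𝓛) (y r t : ℝ) :
    quotient 𝓛 y r t = ∫ s in (0 : ℝ)..r, tailGE 𝓛 (y + t * s) := by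
  rw [quotient]
  split_ifs with ht
  · simp [ht, tailGE]
  · have h1 := intervalIntegral.integral_interval_add_Ioi
      (integrableOn_one_sub_heightCDF hmean y) (integrableOn_one_sub_heightCDF hmean (y + r * t))
    rw [intervalIntegral.integral_congr_ae (g := tailGE 𝓛)
      ((one_sub_heightCDF_ae_eq 𝓛).mono fun u hu _ => hu)] at h1
    rw [intervalIntegral.integral_comp_add_mul (tailGE 𝓛) ht, tailPrimitive, tailPrimitive, ← h1,
      smul_eq_mul, mul_zero, add_zero, mul_comm t r]
    field_simp
    ring

lemma quotient_nonneg (hmean : Integrable (fun h : ℝ≥0 => (h : ℝ)) 𝓛) (y : ℝ) {r : ℝ} (hr : 0 ≤ r)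
    (t : ℝ) : 0 ≤ quotient 𝓛 y r t := by
  rw [quotient_eq_integral hmean]
  exact intervalIntegral.integral_nonneg hr fun _ _ => measureReal_nonneg

/-- The part of the half plane that lies over the interval `]a, b]` and above the line of slope `t`
through `(a, y)`. -/
def strip (a b y t : ℝ) : Set HalfPlane :=
  {q | q.1 ∈ Set.Ioc a b ∧ y + t * (q.1 - a) ≤ (q.2 : ℝ)}

lemma measurableSet_strip (a b y t : ℝ) : MeasurableSet (strip a b y t) := by
  have h1 : MeasurableSet {q : HalfPlane | q.1 ∈ Set.Ioc a b} := measurable_fst measurableSet_Ioc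
  have h2 : MeasurableSet {q : HalfPlane | y + t * (q.1 - a) ≤ (q.2 : ℝ)} :=
    measurableSet_le (by fun_prop) (by fun_prop)
  exact h1.inter h2

/-- By Fubini: the section of the strip over `x` has mass `tailGE 𝓛 (y + t * (x - a))`. -/
lemma measure_strip (hmean : Integrable (fun h : ℝ≥0 => (h : ℝ)) 𝓛) {a b : ℝ} (hab : a ≤ b)
    (y t : ℝ) :
    ((volume : Measure ℝ).prod 𝓛) (strip a b y t) = ENNReal.ofReal (quotient 𝓛 y (b - a) t) := by
  rw [quotient_eq_integral hmean]
  have h2 : ∫ s in (0 : ℝ)..(b - a), tailGE 𝓛 (y + t * s) =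
      ∫ x in a..b, tailGE 𝓛 (y + t * (x - a)) := by
    rw [intervalIntegral.integral_comp_sub_right (fun s => tailGE 𝓛 (y + t * s)) a, sub_self]
  have hm : Measurable fun x : ℝ => tailGE 𝓛 (y + t * (x - a)) :=
    (antitone_tailGE 𝓛).measurable.comp (by fun_prop)
  rw [h2, intervalIntegral.integral_of_le hab, ofReal_integral_eq_lintegral_ofReal,
    Measure.prod_apply (measurableSet_strip a b y t), ← lintegral_indicator measurableSet_Ioc]
  · refine lintegral_congr fun x => ?_
    by_cases hx : x ∈ Set.Ioc a b
    · rw [Set.indicator_of_mem hx, tailGE, ofReal_measureReal]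
      congr 1
      ext h
      simp only [strip, Set.mem_preimage, Set.mem_ofPred_eq, hx, true_and]
    · rw [Set.indicator_of_notMem hx]
      convert measure_empty (μ := 𝓛)
      ext h
      simp only [strip, Set.mem_preimage, Set.mem_ofPred_eq, hx, false_and, Set.mem_empty_iff_false]
  · refine Measure.integrableOn_of_bounded (M := 1) measure_Ioc_lt_top.ne
      hm.aestronglyMeasurable (.of_forall fun x => ?_)
    rw [tailGE, Real.norm_of_nonneg measureReal_nonneg]
    exact measureReal_le_one
  · exact .of_forall fun x => measureReal_nonneg

variable {N : ℕ} (p : Fin (N + 1) → HalfPlane)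

/-- The buildings that would beat the `n`-th point of a configuration. -/
def beating (R : ℝ) (n : ℕ) : Set HalfPlane :=
  strip (xAt p (n - 1)) (xAt p (n - 1) + R) (hAt p (n - 1)) (tAt p n)

lemma forbidden_eq (R : ℝ) : forbidden p R = ⋃ n ∈ Finset.Icc 1 N, beating p R n := by
  ext q
  simp only [forbidden, beating, strip, Set.mem_iUnion, Set.mem_ofPred_eq, exists_prop]
  refine exists_congr fun n => and_congr_right fun _ => and_congr_right fun hq => ?_
  exact le_slope_iff (p := pt p (n - 1)) hq.1 _

/-- The buildings that would beat the `n`-th point of a configuration, but no later point. -/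
def lastBeating (R : ℝ) (n : ℕ) : Set HalfPlane :=
  beating p R n \ (if n = N then ∅ else {q | xAt p n < q.1} ∩ beating p R (n + 1))

variable {p}

lemma measurableSet_lastBeating (R : ℝ) (n : ℕ) : MeasurableSet (lastBeating p R n) := by
  refine (measurableSet_strip _ _ _ _).diff ?_
  split_ifs
  · exact .empty
  · exact (measurableSet_lt (by fun_prop) (by fun_prop)).inter (measurableSet_strip _ _ _ _)

/-- A forbidden point is in the piece of the largest `n` for which it beats the `n`-th point. -/
lemma iUnion_lastBeating (R : ℝ) :
    ⋃ n ∈ Finset.Icc 1 N, lastBeating p R n = forbidden p R := by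
  classical
  rw [forbidden_eq]
  refine Set.Subset.antisymm (Set.iUnion₂_mono fun n _ => Set.sdiff_subset) fun q hq => ?_
  let s := (Finset.Icc 1 N).filter fun n => q ∈ beating p R n
  have hs : s.Nonempty := by
    simp only [Set.mem_iUnion] at hq
    obtain ⟨n, hn, hq⟩ := hq
    exact ⟨n, by simp [s, hq, Finset.mem_Icc.1 hn]⟩
  have hmem := s.max'_mem hs
  set n := s.max' hs
  rw [Finset.mem_filter] at hmem
  simp only [Set.mem_iUnion]
  refine ⟨n, hmem.1, hmem.2, ?_⟩
  split_ifs with hn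
  · simp
  · rintro ⟨-, hq'⟩
    have h1 := Finset.mem_Icc.1 hmem.1
    have := s.le_max' (n + 1) (Finset.mem_filter.2 ⟨by simp; omega, hq'⟩)
    change n + 1 ≤ n at this
    omega

/-- A common point `q` would have to beat point `n + 1`, which piece `n` forbids. This is immediate
if `m = n + 1`. Otherwise `x_{n+1} < q.1 ≤ x_{n-1} + R`, so `t_{n+1} < t_n`, and the line `n + 1`
runs below the line `n` to the right of `x_n`. -/
lemma Admissible.disjoint_lastBeating {R : ℝ} (h : Admissible p R) {n m : ℕ} (hn : 1 ≤ n)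
    (hnm : n < m) (hm : m ≤ N) : Disjoint (lastBeating p R n) (lastBeating p R m) := by
  have hmono := fun {i j : ℕ} => xAt_strictMono h.1 (i := i) (j := j)
  refine Set.disjoint_left.2 fun q hq hq' => ?_
  have hx1 : xAt p (n - 1) < xAt p n := hmono (by omega) (by omega)
  have hxle : ∀ i ≤ m - 1, xAt p i ≤ xAt p (m - 1) := by
    intro i hi
    rcases hi.eq_or_lt with rfl | hi
    · exact le_rfl
    · exact (hmono hi (by omega)).le
  have hqm : xAt p (m - 1) < q.1 := hq'.1.1.1
  have hqn : xAt p n < q.1 := (hxle n (by omega)).trans_lt hqm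
  refine hq.2 ?_
  rw [if_neg (by omega)]
  refine ⟨hqn, ?_⟩
  rcases (show n + 1 ≤ m from hnm).eq_or_lt with rfl | hlt
  · exact hq'.1
  · have hqr := hq.1.1.2
    refine ⟨⟨by simpa using hqn, ?_⟩, ?_⟩
    · simp only [Nat.add_sub_cancel]
      linarith
    · have ht : tAt p (n + 1) < tAt p n := by
        refine (h.2 (n + 1) (by simp; omega)).resolve_right (not_lt.2 ?_)
        rw [show n + 1 - 2 = n - 1 by omega]
        exact (hxle (n + 1) (by omega)).trans (hqm.le.trans hqr)
      have h1 := hq.1.2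
      have h2 : hAt p n = hAt p (n - 1) + tAt p n * (xAt p n - xAt p (n - 1)) :=
        height_eq_add_slope_mul hx1
      have h3 : tAt p (n + 1) * (q.1 - xAt p n) ≤ tAt p n * (q.1 - xAt p n) :=
        mul_le_mul_of_nonneg_right ht.le (by linarith)
      simp only [Nat.add_sub_cancel]
      linarith

lemma Admissible.measure_lastBeating (hmean : Integrable (fun h : ℝ≥0 => (h : ℝ)) 𝓛) {R : ℝ}
    (hR : 0 ≤ R) (h : Admissible p R) {n : ℕ} (hn : n ∈ Finset.Icc 1 N) :
    ((volume : Measure ℝ).prod 𝓛) (lastBeating p R n) =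
      ENNReal.ofReal (quotient 𝓛 (hAt p (n - 1)) (if n = N then R else xAt p n - xAt p (n - 1))
          (tAt p n) +
        if n = N then 0 else
          quotient 𝓛 (hAt p n) (rAt p R n) (min (tAt p n) (tAt p (n + 1))) -
            quotient 𝓛 (hAt p n) (rAt p R n) (tAt p (n + 1))) ∧
      0 ≤ quotient 𝓛 (hAt p (n - 1)) (if n = N then R else xAt p n - xAt p (n - 1)) (tAt p n) +
        if n = N then 0 else
          quotient 𝓛 (hAt p n) (rAt p R n) (min (tAt p n) (tAt p (n + 1))) -
            quotient 𝓛 (hAt p n) (rAt p R n) (tAt p (n + 1)) := by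
  by_cases hnN : n = N
  · simp only [lastBeating, if_pos hnN, Set.sdiff_empty, add_zero]
    refine ⟨?_, quotient_nonneg hmean _ hR _⟩
    rw [beating, measure_strip hmean (by linarith)]
    congr 2
    ring
  · simp only [lastBeating, if_neg hnN]
    have hr := h.1 n hn
    have hx := hr.1
    have hle : xAt p n ≤ xAt p (n - 1) + R := hr.2
    have hr0 : 0 ≤ rAt p R n := by rw [rAt]; linarith
    have hreq : rAt p R n = xAt p (n - 1) + R - xAt p n := by rw [rAt]; ring
    have hh : hAt p n = hAt p (n - 1) + tAt p n * (xAt p n - xAt p (n - 1)) :=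
      height_eq_add_slope_mul hx
    set S₁ := strip (xAt p (n - 1)) (xAt p n) (hAt p (n - 1)) (tAt p n)
    set S₂ := strip (xAt p n) (xAt p (n - 1) + R) (hAt p n) (min (tAt p n) (tAt p (n + 1)))
      with hS₂
    set S₃ := strip (xAt p n) (xAt p (n - 1) + R) (hAt p n) (tAt p (n + 1)) with hS₃
    -- Left of `x_n` nothing is removed. To the right, what remains lies above the line of slope
    -- `t_n` through point `n` and below that of slope `t_{n+1}`; the minimum makes this a
    -- difference of nested strips, empty if `t_{n+1} ≤ t_n`.
    have hsplit : beating p R n \ ({q | xAt p n < q.1} ∩ beating p R (n + 1)) =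
        S₁ ∪ (S₂ \ S₃) := by
      ext q
      simp only [beating, S₁, S₂, S₃, strip, Set.mem_sdiff, Set.mem_inter_iff, Set.mem_union,
        Set.mem_ofPred_eq, Set.mem_Ioc, Nat.add_sub_cancel, not_and, not_le]
      have e1 : hAt p (n - 1) + tAt p n * (q.1 - xAt p (n - 1)) =
        hAt p n + tAt p n * (q.1 - xAt p n) := by rw [hh]; ring
      rw [e1]
      rcases le_or_gt q.1 (xAt p n) with hq | hq
      · constructor
        · rintro ⟨⟨⟨h1, -⟩, h2⟩, -⟩
          exact Or.inl ⟨⟨h1, hq⟩, h2⟩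
        · rintro (⟨⟨h1, -⟩, h2⟩ | ⟨⟨⟨h1, -⟩, -⟩, -⟩)
          · exact ⟨⟨⟨h1, hq.trans hle⟩, h2⟩, fun h' => absurd h' (not_lt.2 hq)⟩
          · exact absurd h1 (not_lt.2 hq)
      · have hmin : min (tAt p n) (tAt p (n + 1)) * (q.1 - xAt p n) =
            min (tAt p n * (q.1 - xAt p n)) (tAt p (n + 1) * (q.1 - xAt p n)) :=
          min_mul_of_nonneg _ _ (by linarith)
        rw [hmin]
        constructor
        · rintro ⟨⟨⟨h1, h1'⟩, h2⟩, h3⟩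
          have h3' := h3 hq ⟨hq, by linarith⟩
          refine Or.inr ⟨⟨⟨hq, h1'⟩, ?_⟩, fun _ => h3'⟩
          linarith [min_le_left (tAt p n * (q.1 - xAt p n)) (tAt p (n + 1) * (q.1 - xAt p n))]
        · rintro (⟨⟨-, h1⟩, -⟩ | ⟨⟨⟨h1, h1'⟩, h2⟩, h3⟩)
          · exact absurd h1 (not_le.2 hq)
          · have h3' := h3 ⟨h1, h1'⟩
            refine ⟨⟨⟨hx.trans hq, h1'⟩, ?_⟩, fun _ _ => h3'⟩
            rcases min_choice (tAt p n * (q.1 - xAt p n)) (tAt p (n + 1) * (q.1 - xAt p n))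
              with hc | hc <;> rw [hc] at h2 <;> linarith
    have hsub : S₃ ⊆ S₂ := by
      intro q hq
      refine ⟨hq.1, le_trans ?_ hq.2⟩
      have := mul_le_mul_of_nonneg_right (min_le_right (tAt p n) (tAt p (n + 1)))
        (show 0 ≤ q.1 - xAt p n by linarith [hq.1.1])
      linarith
    have hdisj : Disjoint S₁ (S₂ \ S₃) :=
      Set.disjoint_left.2 fun q hq hq' => absurd hq.1.2 (not_le.2 hq'.1.1.1)
    have hm2 : ((volume : Measure ℝ).prod 𝓛) S₂ =
        ENNReal.ofReal (quotient 𝓛 (hAt p n) (rAt p R n) (min (tAt p n) (tAt p (n + 1)))) := by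
      rw [hS₂, measure_strip hmean hle, hreq]
    have hm3 : ((volume : Measure ℝ).prod 𝓛) S₃ =
        ENNReal.ofReal (quotient 𝓛 (hAt p n) (rAt p R n) (tAt p (n + 1))) := by
      rw [hS₃, measure_strip hmean hle, hreq]
    have hq3 := quotient_nonneg hmean (hAt p n) hr0 (tAt p (n + 1))
    have hle23 : quotient 𝓛 (hAt p n) (rAt p R n) (tAt p (n + 1)) ≤
        quotient 𝓛 (hAt p n) (rAt p R n) (min (tAt p n) (tAt p (n + 1))) := by
      have := measure_mono (μ := (volume : Measure ℝ).prod 𝓛) hsub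
      rwa [hm2, hm3, ENNReal.ofReal_le_ofReal_iff (quotient_nonneg hmean _ hr0 _)] at this
    have hq1 := quotient_nonneg hmean (hAt p (n - 1)) (sub_nonneg.2 hx.le) (tAt p n)
    refine ⟨?_, by linarith⟩
    rw [hsplit, measure_union hdisj ((measurableSet_strip _ _ _ _).diff (measurableSet_strip _ _ _ _)),
      measure_sdiff hsub (measurableSet_strip _ _ _ _).nullMeasurableSet (by rw [hm3]; simp), hm2, hm3,
      measure_strip hmean hx.le, ← ENNReal.ofReal_sub _ hq3,
      ← ENNReal.ofReal_add hq1 (by linarith)]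

lemma Admissible.measure_forbidden_and_nonneg (hmean : Integrable (fun h : ℝ≥0 => (h : ℝ)) 𝓛)
    {R : ℝ} (hR : 0 ≤ R) (h : Admissible p R) :
    ((volume : Measure ℝ).prod 𝓛) (forbidden p R) = ENNReal.ofReal (exponent p 𝓛 R) ∧
      0 ≤ exponent p 𝓛 R := by
  have hexp : exponent p 𝓛 R = ∑ n ∈ Finset.Icc 1 N,
      (quotient 𝓛 (hAt p (n - 1)) (if n = N then R else xAt p n - xAt p (n - 1)) (tAt p n) +
        if n = N then 0 else
          quotient 𝓛 (hAt p n) (rAt p R n) (min (tAt p n) (tAt p (n + 1))) -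
            quotient 𝓛 (hAt p n) (rAt p R n) (tAt p (n + 1))) := by
    rw [Finset.sum_add_distrib, exponent]
    congr 1
    rw [Finset.sum_ite, Finset.sum_const_zero, zero_add]
    refine Finset.sum_congr ?_ fun _ _ => rfl
    ext n
    simp only [Finset.mem_Ico, Finset.mem_filter, Finset.mem_Icc]
    omega
  have hterm := fun n hn => h.measure_lastBeating hmean hR (n := n) hn
  constructor
  · rw [← iUnion_lastBeating, measure_biUnion_finset, hexp,
      ENNReal.ofReal_sum_of_nonneg fun n hn => (hterm n hn).2]
    · exact Finset.sum_congr rfl fun n hn => (hterm n hn).1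
    · intro n hn m hm hne
      have hn' := Finset.mem_Icc.1 hn
      have hm' := Finset.mem_Icc.1 hm
      rcases hne.lt_or_gt with hlt | hlt
      · exact h.disjoint_lastBeating hn'.1 hlt hm'.2
      · exact (h.disjoint_lastBeating hm'.1 hlt hn'.2).symm
    · exact fun n _ => measurableSet_lastBeating R n
  · rw [hexp]
    exact Finset.sum_nonneg fun n hn => (hterm n hn).2

/-- The exponent is the measure of the set of forbidden buildings. -/
theorem Admissible.measure_forbidden (hmean : Integrable (fun h : ℝ≥0 => (h : ℝ)) 𝓛)
    {R : ℝ} (hR : 0 ≤ R) (h : Admissible p R) :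
    ((volume : Measure ℝ).prod 𝓛) (forbidden p R) = ENNReal.ofReal (exponent p 𝓛 R) :=
  (h.measure_forbidden_and_nonneg hmean hR).1

lemma Admissible.exponent_nonneg (hmean : Integrable (fun h : ℝ≥0 => (h : ℝ)) 𝓛)
    {R : ℝ} (hR : 0 ≤ R) (h : Admissible p R) : 0 ≤ exponent p 𝓛 R :=
  (h.measure_forbidden_and_nonneg hmean hR).2

lemma Admissible.exponent_le (hmean : Integrable (fun h : ℝ≥0 => (h : ℝ)) 𝓛)
    {R : ℝ} (hR : 0 ≤ R) (h : Admissible p R) : exponent p 𝓛 R ≤ N * R := by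
  have h1 : ((volume : Measure ℝ).prod 𝓛) (forbidden p R) ≤ ENNReal.ofReal (N * R) := by
    rw [forbidden_eq]
    refine (measure_biUnion_finset_le _ _).trans ?_
    calc _ ≤ ∑ n ∈ Finset.Icc 1 N, ENNReal.ofReal R := by
          refine Finset.sum_le_sum fun n _ => ?_
          have : beating p R n ⊆ Set.Ioc (xAt p (n - 1)) (xAt p (n - 1) + R) ×ˢ Set.univ :=
            fun q hq => ⟨hq.1, trivial⟩
          refine (measure_mono this).trans ?_
          rw [Measure.prod_prod, Real.volume_Ioc, measure_univ, mul_one, add_sub_cancel_left]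
      _ = ENNReal.ofReal (N * R) := by
          rw [Finset.sum_const, Nat.card_Icc, Nat.add_sub_cancel, nsmul_eq_mul,
            ENNReal.ofReal_mul (by positivity), ENNReal.ofReal_natCast]
  rwa [h.measure_forbidden hmean hR, ENNReal.ofReal_le_ofReal_iff (by positivity)] at h1

/-! ### Measurability of the density -/

lemma measurable_pt (n : ℕ) : Measurable fun p : Fin (N + 1) → HalfPlane => pt p n :=
  measurable_pi_apply _

lemma measurable_xAt (n : ℕ) : Measurable fun p : Fin (N + 1) → HalfPlane => xAt p n :=
  measurable_fst.comp (measurable_pt n)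

lemma measurable_hAt (n : ℕ) : Measurable fun p : Fin (N + 1) → HalfPlane => hAt p n :=
  measurable_coe_nnreal_real.comp (measurable_snd.comp (measurable_pt n))

lemma measurable_tAt (n : ℕ) : Measurable fun p : Fin (N + 1) → HalfPlane => tAt p n :=
  ((measurable_hAt n).sub (measurable_hAt (n - 1))).div
    ((measurable_xAt n).sub (measurable_xAt (n - 1)))

lemma measurable_rAt (R : ℝ) (n : ℕ) :
    Measurable fun p : Fin (N + 1) → HalfPlane => rAt p R n :=
  measurable_const.sub ((measurable_xAt n).sub (measurable_xAt (n - 1)))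

lemma measurable_quotient (hmean : Integrable (fun h : ℝ≥0 => (h : ℝ)) 𝓛) {α : Type*}
    [MeasurableSpace α] {y r t : α → ℝ} (hy : Measurable y) (hr : Measurable r)
    (ht : Measurable t) : Measurable fun a => quotient 𝓛 (y a) (r a) (t a) := by
  have hT := (monotone_tailPrimitive hmean).measurable
  refine Measurable.ite (measurableSet_eq_fun ht measurable_const)
    (hr.mul ((antitone_tailGE 𝓛).measurable.comp hy)) ?_
  exact ((hT.comp (hy.add (hr.mul ht))).sub (hT.comp hy)).div ht

lemma measurable_exponent (hmean : Integrable (fun h : ℝ≥0 => (h : ℝ)) 𝓛) (R : ℝ) :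
    Measurable fun p : Fin (N + 1) → HalfPlane => exponent p 𝓛 R := by
  refine (Finset.measurable_sum _ fun n _ => ?_).add (Finset.measurable_sum _ fun n _ => ?_)
  · refine measurable_quotient hmean (measurable_hAt _) ?_ (measurable_tAt _)
    split_ifs
    · exact measurable_const
    · exact (measurable_xAt n).sub (measurable_xAt (n - 1))
  · exact (measurable_quotient hmean (measurable_hAt _) (measurable_rAt R _)
      ((measurable_tAt n).min (measurable_tAt (n + 1)))).sub
      (measurable_quotient hmean (measurable_hAt _) (measurable_rAt R _) (measurable_tAt (n + 1)))

lemma measurableSet_admissible (N : ℕ) (R : ℝ) :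
    MeasurableSet {p : Fin (N + 1) → HalfPlane | Admissible p R} := by
  have h1 : MeasurableSet {p : Fin (N + 1) → HalfPlane | ∀ i ∈ Finset.Icc 1 N,
      xAt p i ∈ Set.Ioc (xAt p (i - 1)) (xAt p (i - 1) + R)} := by
    simp only [Set.ofPred_forall]
    refine .iInter fun i => .iInter fun _ => ?_
    exact (measurableSet_lt (measurable_xAt _) (measurable_xAt _)).inter
      (measurableSet_le (measurable_xAt _) ((measurable_xAt _).add_const _))
  have h2 : MeasurableSet {p : Fin (N + 1) → HalfPlane | ∀ i ∈ Finset.Icc 2 N,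
      tAt p i < tAt p (i - 1) ∨ xAt p (i - 2) + R < xAt p i} := by
    simp only [Set.ofPred_forall]
    refine .iInter fun i => .iInter fun _ => ?_
    exact (measurableSet_lt (measurable_tAt _) (measurable_tAt _)).union
      (measurableSet_lt ((measurable_xAt _).add_const _) (measurable_xAt _))
  exact h1.inter h2

lemma measurable_density (hmean : Integrable (fun h : ℝ≥0 => (h : ℝ)) 𝓛) (N : ℕ) (lam : ℝ≥0)
    (R : ℝ) : Measurable fun p : Fin (N + 1) → HalfPlane => density p lam 𝓛 R := by
  refine Measurable.ite (measurableSet_admissible N R) ?_ measurable_const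
  have := measurable_exponent (N := N) hmean R
  fun_prop

lemma measurableSet_mem_forbidden (N : ℕ) (R : ℝ) :
    MeasurableSet {a : (Fin (N + 1) → HalfPlane) × HalfPlane | a.2 ∈ forbidden a.1 R} := by
  have hset : {a : (Fin (N + 1) → HalfPlane) × HalfPlane | a.2 ∈ forbidden a.1 R} =
      ⋃ n ∈ Finset.Icc 1 N, {a | xAt a.1 (n - 1) < a.2.1 ∧ a.2.1 ≤ xAt a.1 (n - 1) + R ∧
        hAt a.1 (n - 1) + tAt a.1 n * (a.2.1 - xAt a.1 (n - 1)) ≤ (a.2.2 : ℝ)} := by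
    ext a
    simp only [forbidden_eq, beating, strip, Set.mem_iUnion, Set.mem_ofPred_eq, Set.mem_Ioc,
      and_assoc]
  rw [hset]
  refine Finset.measurableSet_biUnion _ fun n _ => ?_
  have hf : Measurable (Prod.fst : (Fin (N + 1) → HalfPlane) × HalfPlane → _) := measurable_fst
  have hx := (measurable_xAt (n - 1)).comp hf
  have hh := (measurable_hAt (n - 1)).comp hf
  have ht := (measurable_tAt n).comp hf
  have hq : Measurable fun a : (Fin (N + 1) → HalfPlane) × HalfPlane => a.2.1 := by fun_prop
  have hq' : Measurable fun a : (Fin (N + 1) → HalfPlane) × HalfPlane => (a.2.2 : ℝ) := by fun_prop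
  exact (measurableSet_lt hx hq).inter ((measurableSet_le hq (hx.add_const R)).inter
    (measurableSet_le (hh.add (ht.mul (hq.sub hx))) hq'))

end Exponent

/-! ### The law of the blockage sequence -/

section Law

lemma measurable_cons (N : ℕ) :
    Measurable fun q : HalfPlane × (Fin N → HalfPlane) =>
      (Fin.cons q.1 q.2 : Fin (N + 1) → HalfPlane) := by
  refine measurable_pi_lambda _ fun i => ?_
  refine Fin.cases ?_ (fun i => ?_) i
  · exact measurable_fst
  · exact (measurable_pi_apply i).comp measurable_snd

lemma map_cons_prod_pi (μ : Measure HalfPlane) [IsProbabilityMeasure μ] (𝓛 : Measure ℝ≥0)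
    [IsProbabilityMeasure 𝓛] (lam : ℝ≥0) (N : ℕ) :
    (μ.prod (Measure.pi fun _ : Fin N => (lam • volume : Measure ℝ).prod 𝓛)).map
      (fun q => (Fin.cons q.1 q.2 : Fin (N + 1) → HalfPlane)) =
        (lam : ℝ≥0∞) ^ N • refMeasure μ 𝓛 N := by
  let ν : Fin (N + 1) → Measure HalfPlane := fun i =>
    if i = 0 then μ else (lam • volume : Measure ℝ).prod 𝓛
  have hν : ∀ i, SigmaFinite (ν i) := fun i => by
    simp only [ν]
    split_ifs <;> infer_instance
  have hν' : ∀ i : Fin (N + 1), SigmaFinite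
      (if i = 0 then μ else (volume : Measure ℝ).prod 𝓛) := fun i => by
    split_ifs <;> infer_instance
  have h1 : (μ.prod (Measure.pi fun _ : Fin N => (lam • volume : Measure ℝ).prod 𝓛)).map
      (fun q => (Fin.cons q.1 q.2 : Fin (N + 1) → HalfPlane)) = Measure.pi ν := by
    refine (Measure.pi_eq fun s hs => ?_).symm
    have hpre : (fun q : HalfPlane × (Fin N → HalfPlane) =>
        (Fin.cons q.1 q.2 : Fin (N + 1) → HalfPlane)) ⁻¹' Set.univ.pi s =
        s 0 ×ˢ Set.univ.pi fun i : Fin N => s i.succ := by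
      ext q
      simp only [Set.mem_preimage, Set.mem_univ_pi, Set.mem_prod, Fin.forall_fin_succ,
        Fin.cons_zero, Fin.cons_succ]
    rw [Measure.map_apply (measurable_cons N) (.univ_pi hs), hpre, Measure.prod_prod,
      Measure.pi_pi, Fin.prod_univ_succ]
    simp [ν]
  rw [h1, refMeasure]
  refine Measure.pi_eq fun s hs => ?_
  rw [Measure.smul_apply, Measure.pi_pi, Fin.prod_univ_succ, Fin.prod_univ_succ]
  simp only [ν, Fin.succ_ne_zero, if_true, if_false, smul_eq_mul, Measure.prod_smul_left,
    Measure.smul_apply, ENNReal.smul_def, Finset.prod_mul_distrib, Finset.prod_const,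
    Finset.card_univ, Fintype.card_fin]
  ring

lemma Admissible.mem_Ioc {N : ℕ} {p : Fin (N + 1) → HalfPlane} {R : ℝ} (h : Admissible p R)
    (i : Fin N) : (p i.succ).1 ∈ Set.Ioc (p 0).1 ((p 0).1 + N * R) := by
  have hR : ∀ n ≤ N, xAt p n ≤ xAt p 0 + n * R := by
    intro n hn
    induction n with
    | zero => simp
    | succ n ih =>
      have h1 := (h.1 (n + 1) (by simp; omega)).2
      simp only [Nat.add_sub_cancel] at h1
      have := ih (by omega)
      push_cast
      linarith
  have hR0 : 0 ≤ R := by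
    have h1 := h.1 1 (by simp; have := i.2; omega)
    linarith [h1.1.trans_le h1.2]
  have h0 : xAt p 0 = (p 0).1 := by rw [xAt, pt_zero]
  have hi : xAt p (i.1 + 1) = (p i.succ).1 := by
    rw [xAt, ← pt_coe p i.succ, Fin.val_succ]
  rw [← h0, ← hi]
  refine ⟨xAt_strictMono h.1 (by omega) (by omega), (hR _ (by omega)).trans ?_⟩
  have : ((i.1 + 1 : ℕ) : ℝ) ≤ N := by exact_mod_cast i.2
  gcongr

/-- All bases lie within `N * R` of the start, so for each start the mass is at most `(lam * N * R)
^ N`. -/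
lemma measure_admissible_ne_top (μ : Measure HalfPlane) [IsProbabilityMeasure μ] (𝓛 : Measure ℝ≥0)
    [IsProbabilityMeasure 𝓛] (lam : ℝ≥0) (N : ℕ) (R : ℝ) :
    (μ.prod (Measure.pi fun _ : Fin N => (lam • volume : Measure ℝ).prod 𝓛))
      {q | Admissible (Fin.cons q.1 q.2 : Fin (N + 1) → HalfPlane) R} ≠ ∞ := by
  have hm : MeasurableSet {q : HalfPlane × (Fin N → HalfPlane) |
      Admissible (Fin.cons q.1 q.2 : Fin (N + 1) → HalfPlane) R} :=
    measurable_cons N (measurableSet_admissible N R)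
  rw [Measure.prod_apply hm]
  refine ne_top_of_le_ne_top (b := ∫⁻ _, (lam * ENNReal.ofReal (N * R)) ^ N ∂μ) ?_
    (lintegral_mono fun s => ?_)
  · rw [lintegral_const, measure_univ, mul_one]
    exact ENNReal.pow_ne_top (ENNReal.mul_ne_top ENNReal.coe_ne_top ENNReal.ofReal_ne_top)
  · have hsub : Prod.mk s ⁻¹' {q : HalfPlane × (Fin N → HalfPlane) |
        Admissible (Fin.cons q.1 q.2 : Fin (N + 1) → HalfPlane) R} ⊆
        Set.univ.pi fun _ => Set.Ioc s.1 (s.1 + N * R) ×ˢ Set.univ :=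
      fun z hz i _ => ⟨Admissible.mem_Ioc (p := Fin.cons s z) hz i, trivial⟩
    refine (measure_mono hsub).trans_eq ((Measure.pi_pi
      (fun _ : Fin N => (lam • volume : Measure ℝ).prod 𝓛) _).trans ?_)
    simp only [Measure.prod_prod, Measure.smul_apply, ENNReal.smul_def,
      Real.volume_Ioc, measure_univ, mul_one, Finset.prod_const, Finset.card_univ,
      Fintype.card_fin, add_sub_cancel_left, smul_eq_mul]

/-! ### Decomposition of the path event over index tuples -/

variable {Ω : Type*}

/-- The configuration formed by the starting point and the buildings with indices `k i`. -/
def config (X : ℕ → Ω → ℝ) (H : ℕ → Ω → ℝ≥0) (start : Ω → HalfPlane) {N : ℕ} (k : Fin N → ℕ)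
    (ω : Ω) : Fin (N + 1) → HalfPlane :=
  Fin.cons (start ω) fun i => (X (k i) ω, H (k i) ω)

/-- The event that the buildings with indices `k i` are the first points of the blockage
sequence. -/
def pathEvent (R : ℝ) (X : ℕ → Ω → ℝ) (H : ℕ → Ω → ℝ≥0) (start : Ω → HalfPlane) {N : ℕ}
    (k : Fin N → ℕ) : Set Ω :=
  {ω | IsPath (config X H start k ω) R (landscape X H ω)}

variable {R : ℝ} {X : ℕ → Ω → ℝ} {H : ℕ → Ω → ℝ≥0} {start : Ω → HalfPlane} {N : ℕ}

lemma pt_config_mem (k : Fin N → ℕ) (ω : Ω) {n : ℕ} (hn : n ∈ Finset.Icc 1 N) :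
    pt (config X H start k ω) n ∈ landscape X H ω := by
  rw [Finset.mem_Icc] at hn
  have h := pt_coe (config X H start k ω) (⟨n - 1, by omega⟩ : Fin N).succ
  rw [show (((⟨n - 1, by omega⟩ : Fin N).succ : Fin (N + 1)) : ℕ) = n by
    simp only [Fin.succ_mk]; omega] at h
  rw [h]
  exact ⟨k ⟨n - 1, by omega⟩, rfl⟩

lemma blockageSeq_of_mem_pathEvent {k : Fin N → ℕ} {ω : Ω} (h : ω ∈ pathEvent R X H start k)
    {n : ℕ} (hn : n ≤ N) : blockageSeq R (landscape X H ω) (start ω) n =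
      some (pt (config X H start k ω) n) :=
  IsPath.blockageSeq_eq h hn

lemma blockagePath_of_mem_pathEvent {k : Fin N → ℕ} {ω : Ω} (h : ω ∈ pathEvent R X H start k) :
    blockagePath R (landscape X H) start N ω = config X H start k ω := by
  ext1 n
  rw [blockagePath, blockageSeq_of_mem_pathEvent h (by omega), Option.getD_some, pt_coe]

/-- Bases increase strictly along a path, so no index repeats and embeddings suffice. -/
lemma alwaysFound_eq : alwaysFound R (landscape X H) start N =
    ⋃ k : Fin N ↪ ℕ, pathEvent R X H start k := by
  ext ω
  rw [Set.mem_iUnion]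
  constructor
  · intro h
    have hp := isPath_of_isSome h
    have hmem : ∀ i : Fin N, ∃ j, (X j ω, H j ω) =
        blockagePath R (landscape X H) start N ω i.succ := by
      intro i
      obtain ⟨j, hj⟩ := (hp (i.1 + 1) (by simp)).1
      refine ⟨j, hj.trans ?_⟩
      exact pt_coe _ i.succ
    choose k hk using hmem
    have hconf : config X H start k ω = blockagePath R (landscape X H) start N ω := by
      ext1 n
      refine Fin.cases ?_ (fun i => ?_) n
      · rfl
      · rw [config, Fin.cons_succ, hk]
    have hstrict := fun {i j : ℕ} => xAt_strictMono (fun n hn => (hp n hn).2.1) (i := i) (j := j)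
    have hkinj : Function.Injective k := by
      have hlt : ∀ i j : Fin N, i < j → k i ≠ k j := by
        intro i j hij he
        have h1 : xAt _ (i.1 + 1) < xAt _ (j.1 + 1) :=
          hstrict (by have : i.1 < j.1 := hij; omega) (by omega)
        have h2 : (pt (blockagePath R (landscape X H) start N ω) (i.1 + 1)).1 <
          (pt (blockagePath R (landscape X H) start N ω) (j.1 + 1)).1 := h1
        rw [← Fin.val_succ, ← Fin.val_succ, pt_coe, pt_coe, ← hk, ← hk, he] at h2
        exact lt_irrefl _ h2
      intro i j he
      rcases lt_trichotomy i j with hl | hl | hl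
      · exact absurd he (hlt i j hl)
      · exact hl
      · exact absurd he.symm (hlt j i hl)
    refine ⟨⟨k, hkinj⟩, ?_⟩
    change IsPath (config X H start k ω) R _
    rw [hconf]
    exact hp
  · rintro ⟨k, hk⟩ n hn
    rw [blockageSeq_of_mem_pathEvent hk hn, Option.isSome_some]

variable [MeasurableSpace Ω]

lemma measurable_config (hX : ∀ k, Measurable (X k)) (hH : ∀ k, Measurable (H k))
    (hstart : Measurable start) (k : Fin N → ℕ) : Measurable (config X H start k) :=
  (measurable_cons N).comp (hstart.prodMk (measurable_pi_lambda _ fun _ => (hX _).prodMk (hH _)))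

lemma measurable_slope {f g : Ω → HalfPlane} (hf : Measurable f) (hg : Measurable g) :
    Measurable fun ω => slope (f ω) (g ω) := by
  unfold slope
  fun_prop

lemma measurableSet_pathEvent (hX : ∀ k, Measurable (X k)) (hH : ∀ k, Measurable (H k))
    (hstart : Measurable start) (k : Fin N → ℕ) : MeasurableSet (pathEvent R X H start k) := by
  have hset : pathEvent R X H start k = ⋂ n ∈ Finset.Icc 1 N,
      ({ω | (pt (config X H start k ω) (n - 1)).1 < (pt (config X H start k ω) n).1} ∩
        {ω | (pt (config X H start k ω) n).1 ≤ (pt (config X H start k ω) (n - 1)).1 + R}) ∩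
      ⋂ j, {ω | (pt (config X H start k ω) (n - 1)).1 < X j ω →
        X j ω ≤ (pt (config X H start k ω) (n - 1)).1 + R →
        (X j ω, H j ω) ≠ pt (config X H start k ω) n →
        slope (pt (config X H start k ω) (n - 1)) (X j ω, H j ω) <
          slope (pt (config X H start k ω) (n - 1)) (pt (config X H start k ω) n)} := by
    ext ω
    simp only [Set.mem_iInter, Set.mem_inter_iff, Set.mem_ofPred_eq]
    refine forall₂_congr fun n hn => ?_
    constructor
    · intro h
      exact ⟨h.2.1, fun j h1 h2 h3 => h.2.2 _ ⟨j, rfl⟩ ⟨h1, h2⟩ h3⟩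
    · rintro ⟨h1, h2⟩
      refine ⟨pt_config_mem k ω hn, h1, ?_⟩
      rintro _ ⟨j, rfl⟩ h3 h4
      exact h2 j h3.1 h3.2 h4
  rw [hset]
  refine Finset.measurableSet_biInter _ fun n _ => ?_
  have hc := measurable_config hX hH hstart k
  have h1 : Measurable fun ω => pt (config X H start k ω) (n - 1) := (measurable_pt _).comp hc
  have h2 : Measurable fun ω => pt (config X H start k ω) n := (measurable_pt _).comp hc
  refine ((measurableSet_lt h1.fst h2.fst).inter
    (measurableSet_le h2.fst (h1.fst.add_const R))).inter (.iInter fun j => ?_)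
  have h3 : Measurable fun ω => (X j ω, H j ω) := (hX j).prodMk (hH j)
  exact (measurableSet_lt h1.fst (hX j)).imp ((measurableSet_le (hX j) (h1.fst.add_const R)).imp
    ((measurableSet_eq_fun h3 h2).compl.imp
      (measurableSet_lt (measurable_slope h1 h3) (measurable_slope h1 h2))))

/-- The restriction of the law of the blockage sequence to the event that all blocking buildings
are found. -/
theorem map_blockagePath {P : Measure Ω} [IsProbabilityMeasure P] {lam : ℝ≥0} (hR : 0 < R)
    {𝓛 : Measure ℝ≥0} [IsProbabilityMeasure 𝓛] (hmean : Integrable (fun h : ℝ≥0 => (h : ℝ)) 𝓛)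
    (hL : IsPoissonBuildingProcess P lam 𝓛 X H) (hstart : Measurable start)
    (hindep : IndepFun start (fun ω k => (X k ω, H k ω)) P)
    (haem : AEMeasurable (blockagePath R (landscape X H) start N)
      (P.restrict (alwaysFound R (landscape X H) start N))) :
    (P.restrict (alwaysFound R (landscape X H) start N)).map
        (blockagePath R (landscape X H) start N) =
      (refMeasure (P.map start) 𝓛 N).withDensity fun p => density p lam 𝓛 R := by
  classical
  have hXm := hL.bases.measurable
  have hHm := hL.heights_measurable
  have hcount : Countable (Fin N ↪ ℕ) := DFunLike.coe_injective.countable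
  have hμ : IsProbabilityMeasure (P.map start) :=
    Measure.isProbabilityMeasure_map hstart.aemeasurable
  have hconf := fun k : Fin N ↪ ℕ => measurable_config hXm hHm hstart k
  have hevent := fun k : Fin N ↪ ℕ => measurableSet_pathEvent (R := R) hXm hHm hstart k
  have hfound : MeasurableSet (alwaysFound R (landscape X H) start N) := by
    rw [alwaysFound_eq]
    exact .iUnion hevent
  ext A hA
  -- Admissibility goes into the weight `f`, because the exponent is identified with the forbidden
  -- measure only there.
  let A' : Set (Fin (N + 1) → HalfPlane) := A ∩ {p | Admissible p R}
  have hA' : MeasurableSet A' := hA.inter (measurableSet_admissible N R)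
  let c : HalfPlane × (Fin N → HalfPlane) → Fin (N + 1) → HalfPlane := fun q => Fin.cons q.1 q.2
  have hc : Measurable c := measurable_cons N
  let f : HalfPlane × (Fin N → HalfPlane) → ℝ≥0∞ := fun q => A'.indicator 1 (c q)
  have hf : Measurable f := (measurable_one.indicator hA').comp hc
  have hfA : ∀ q, f q ≠ 0 → Admissible (c q) R := fun q hq =>
    (Set.mem_of_indicator_ne_zero hq).2
  let V : Set ((HalfPlane × (Fin N → HalfPlane)) × HalfPlane) :=
    {a | a.2 ∈ forbidden (c a.1) R}
  have hV : MeasurableSet V :=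
    ((hc.comp measurable_fst).prodMk measurable_snd) (measurableSet_mem_forbidden N R)
  let v : HalfPlane × (Fin N → HalfPlane) → ℝ := fun q => lam * exponent (c q) 𝓛 R
  have hexp : Measurable fun p : Fin (N + 1) → HalfPlane => exponent p 𝓛 R :=
    measurable_exponent hmean R
  have hv : Measurable v := (hexp.comp hc).const_mul _
  have hv0 : ∀ q, f q ≠ 0 → 0 ≤ v q := fun q hq =>
    mul_nonneg lam.2 ((hfA q hq).exponent_nonneg hmean hR.le)
  set π := (P.map start).prod (Measure.pi fun _ : Fin N => (lam • volume : Measure ℝ).prod 𝓛)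
    with hπ
  have hvoid := tsum_lintegral_void (P := P) (ν := P.map start)
    (Λ := (lam • volume : Measure ℝ).prod 𝓛) hstart
    (Z := fun j ω => (X j ω, H j ω)) (fun j => (hXm j).prodMk (hHm j)) (ι := Fin N)
    (fun m => sum_map_buildings hL hstart hindep (Fin N ⊕ Fin m)) hf hV hv hv0
    (fun q hq => by
      change ((lam • volume : Measure ℝ).prod 𝓛) (forbidden (c q) R) = _
      rw [Measure.prod_smul_left, Measure.smul_apply, (hfA q hq).measure_forbidden hmean hR.le,
        ENNReal.smul_def, smul_eq_mul, ← ENNReal.ofReal_coe_nnreal, ← ENNReal.ofReal_mul lam.coe_nonneg])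
    (by
      refine ne_top_of_le_ne_top (b := ∫⁻ q, ENNReal.ofReal (Real.exp (lam * (N * R))) *
        {q | Admissible (c q) R}.indicator 1 q ∂π) ?_ (lintegral_mono fun q => ?_)
      · have hS : MeasurableSet {q | Admissible (c q) R} := hc (measurableSet_admissible N R)
        rw [lintegral_const_mul _ (measurable_one.indicator hS), lintegral_indicator_one hS]
        exact ENNReal.mul_ne_top ENNReal.ofReal_ne_top
          (measure_admissible_ne_top (P.map start) 𝓛 lam N R)
      · by_cases hq : f q = 0
        · simp [hq]
        · have hq1 : f q ≤ {q | Admissible (c q) R}.indicator 1 q := by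
            rw [Set.indicator_of_mem (show q ∈ {q | Admissible (c q) R} from hfA q hq)]
            exact Set.indicator_le_self' (fun _ _ => zero_le_one) (c q)
          dsimp only
          rw [mul_comm]
          refine mul_le_mul' (ENNReal.ofReal_le_ofReal (Real.exp_le_exp.2 ?_)) hq1
          exact mul_le_mul_of_nonneg_left ((hfA q hq).exponent_le hmean hR.le) lam.2)
  rw [Measure.map_apply_of_aemeasurable haem hA, Measure.restrict_apply₀' hfound.nullMeasurableSet]
  have hdecomp : blockagePath R (landscape X H) start N ⁻¹' A ∩
      alwaysFound R (landscape X H) start N =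
      ⋃ k : Fin N ↪ ℕ, pathEvent R X H start k ∩ config X H start k ⁻¹' A := by
    rw [alwaysFound_eq, Set.inter_iUnion]
    refine Set.iUnion_congr fun k => ?_
    ext ω
    constructor
    · rintro ⟨h1, h2⟩
      refine ⟨h2, ?_⟩
      rwa [Set.mem_preimage, ← blockagePath_of_mem_pathEvent h2]
    · rintro ⟨h1, h2⟩
      refine ⟨?_, h1⟩
      rwa [Set.mem_preimage, blockagePath_of_mem_pathEvent h1]
  have hmeas := fun k : Fin N ↪ ℕ => (hevent k).inter (hconf k hA)
  -- The path determines its bases, and almost surely a base determines its index.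
  have hdisj : Pairwise (Function.onFun (AEDisjoint P) fun k : Fin N ↪ ℕ =>
      pathEvent R X H start k ∩ config X H start k ⁻¹' A) := by
    intro k k' hkk'
    refine measure_mono_null ?_ (ae_iff.1 hL.bases.simple)
    rintro ω ⟨⟨h1, -⟩, ⟨h2, -⟩⟩ hinj
    refine hkk' (DFunLike.ext _ _ fun i => hinj ?_)
    have he := (blockagePath_of_mem_pathEvent h1).symm.trans (blockagePath_of_mem_pathEvent h2)
    exact congrArg Prod.fst (congrFun he i.succ)
  have hterm : ∀ k : Fin N ↪ ℕ, P (pathEvent R X H start k ∩ config X H start k ⁻¹' A) =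
      ∫⁻ ω, f (start ω, fun i => (X (k i) ω, H (k i) ω)) *
        (if ∀ j ∉ Set.range k, ((start ω, fun i => (X (k i) ω, H (k i) ω)), (X j ω, H j ω)) ∉ V
          then 1 else 0) ∂P := by
    intro k
    rw [← lintegral_indicator_one (hmeas k)]
    refine lintegral_congr_ae ?_
    filter_upwards [hL.bases.simple] with ω hω
    have hiff := isPath_iff (R := R) (Z := fun j => (X j ω, H j ω)) hω (start ω) k
      (p := config X H start k ω) rfl
    simp only [Set.indicator_apply, Pi.one_apply, f, A', c, V, Set.mem_inter_iff,
      Set.mem_ofPred_eq, Set.mem_preimage, pathEvent]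
    rw [ite_zero_mul_ite_zero, mul_one]
    refine if_congr ?_ rfl rfl
    change IsPath (config X H start k ω) R (Set.range fun j => (X j ω, H j ω)) ∧ _ ↔ _
    rw [hiff]
    change _ ↔ (config X H start k ω ∈ A ∧ Admissible (config X H start k ω) R) ∧ _
    tauto
  rw [hdecomp, measure_iUnion₀ hdisj fun k => (hmeas k).nullMeasurableSet]
  simp_rw [hterm]
  rw [hvoid]
  have hg : Measurable fun p : Fin (N + 1) → HalfPlane =>
      A'.indicator (1 : (Fin (N + 1) → HalfPlane) → ℝ≥0∞) p * ENNReal.ofReal (Real.exp (-(lam * exponent p 𝓛 R))) :=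
    (measurable_one.indicator hA').mul (by fun_prop)
  rw [← lintegral_map hg hc, map_cons_prod_pi, lintegral_smul_measure, withDensity_apply _ hA,
    ← lintegral_indicator hA, smul_eq_mul, ← lintegral_const_mul _ hg]
  refine lintegral_congr fun p => ?_
  by_cases hp : p ∈ A
  · by_cases hadm : Admissible p R
    · rw [Set.indicator_of_mem (show p ∈ A' from ⟨hp, hadm⟩), Set.indicator_of_mem hp, density,
        if_pos hadm, Pi.one_apply, one_mul, ENNReal.ofReal_mul (by positivity),
        ENNReal.ofReal_pow lam.coe_nonneg, ENNReal.ofReal_coe_nnreal, neg_mul]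
    · rw [Set.indicator_of_notMem (fun h => hadm h.2 : p ∉ A'), Set.indicator_of_mem hp, density,
        if_neg hadm, zero_mul, mul_zero]
  · rw [Set.indicator_of_notMem (fun h => hp h.1 : p ∉ A'), Set.indicator_of_notMem hp, zero_mul,
      mul_zero]

end Law
end Blockage

end

/-! ### Measurability of the path and conclusion -/

theorem mainTheorem10 {Ω : Type*} [MeasurableSpace Ω] (P : Measure Ω) [IsProbabilityMeasure P]
    (lam : ℝ≥0) (hlam : 0 < lam) (R : ℝ) (hR : 0 < R)
    (𝓛 : Measure ℝ≥0) [IsProbabilityMeasure 𝓛] (hmean : Integrable (fun h : ℝ≥0 => (h : ℝ)) 𝓛)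
    (X : ℕ → Ω → ℝ) (H : ℕ → Ω → ℝ≥0)
    (hL : Blockage.IsPoissonBuildingProcess P lam 𝓛 X H)
    (μ : Measure Blockage.HalfPlane) (start : Ω → Blockage.HalfPlane)
    (hstart : Measurable start) (hμ : P.map start = μ)
    (hindep : IndepFun start (fun ω k => (X k ω, H k ω)) P)
    (N : ℕ) :
    -- the restricted law of the blockage sequence has density `g_{N,R}`
    (NullMeasurableSet (Blockage.alwaysFound R (Blockage.landscape X H) start N) P ∧
      AEMeasurable (Blockage.blockagePath R (Blockage.landscape X H) start N)
        (P.restrict (Blockage.alwaysFound R (Blockage.landscape X H) start N)) ∧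
      Measurable (fun p : Fin (N + 1) → Blockage.HalfPlane => Blockage.density p lam 𝓛 R) ∧
      (P.restrict (Blockage.alwaysFound R (Blockage.landscape X H) start N)).map
          (Blockage.blockagePath R (Blockage.landscape X H) start N) =
        (Blockage.refMeasure μ 𝓛 N).withDensity (fun p => Blockage.density p lam 𝓛 R)) ∧
    -- the explicit form of the exponent for non-zero slopes
    (1 ≤ N → ∀ p : Fin (N + 1) → Blockage.HalfPlane,
      (∀ i ∈ Finset.Icc 1 N, Blockage.xAt p (i - 1) < Blockage.xAt p i ∧ Blockage.tAt p i ≠ 0) →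
        Blockage.exponent p 𝓛 R = Blockage.expandedExponent p 𝓛 R) := by

  have hXm := hL.bases.measurable
  have hHm := hL.heights_measurable
  have hevent := fun k : Fin N ↪ ℕ =>
    Blockage.measurableSet_pathEvent (R := R) hXm hHm hstart k
  have hcount : Countable (Fin N ↪ ℕ) := DFunLike.coe_injective.countable
  have haem : AEMeasurable (Blockage.blockagePath R (Blockage.landscape X H) start N)
      (P.restrict (Blockage.alwaysFound R (Blockage.landscape X H) start N)) := by
    -- On each of the countably many path events the path coincides with a measurable configuration,
    -- so measurability of `blocking` is not needed.
    rw [Blockage.alwaysFound_eq, aemeasurable_iUnion_iff]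
    intro k
    refine ⟨Blockage.config X H start k, Blockage.measurable_config hXm hHm hstart k, ?_⟩
    filter_upwards [ae_restrict_mem (hevent k)] with ω hω
    exact Blockage.blockagePath_of_mem_pathEvent hω
  refine ⟨⟨?_, haem, Blockage.measurable_density hmean N lam R, ?_⟩,
    fun hN p hp => Blockage.exponent_eq_expandedExponent hN 𝓛 R p hp⟩
  · rw [Blockage.alwaysFound_eq]
    exact (MeasurableSet.iUnion hevent).nullMeasurableSet
  · rw [← hμ]
    exact Blockage.map_blockagePath hR hmean hL hstart hindep haem
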